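/- Let $b_\pm>0$, $c>0$ and $\delta_\pm\in\mathbb R$ with $b_\pm+\delta_\pm>0$. Define $$b_n=\begin{cases}b_+,&n\ge 0\\ b_-,&n\le -1,\end{cases}\qquad c_n=\begin{cases}b_++\delta_+,&n\ge 0\\ c,&n=-1\\ b_-+\delta_-,&n\le -2,\end{cases}\qquad d_n=\begin{cases}b_++\delta_+,&n\ge 0\\ c,&n=-1,-2\\ b_-+\delta_-,&n\le -3.\end{cases}$$ For $k\in\mathbb R$ let $\widehat H_{\mathrm{II}}(k)$ be the operator on $\ell^2(\mathbb Z;\mathbb C^6)$ (the Floquet–Bloch Hamiltonian with quasi-momentum $k$ of the nearest-neighbour tight-binding model with a type-II, or armchair, interface) given, for $\mathbf w=\{(w_{j,n})_{j=1}^6\}_{n\in\mathbb Z}$, by $$\begin{aligned} (\widehat H_{\mathrm{II}}(k)\mathbf w)_{1,n}&=-b_nw_{4,n}-b_nw_{5,n}-c_ne^{-ik}w_{6,n+1},\\ (\widehat H_{\mathrm{II}}(k)\mathbf w)_{2,n}&=-b_nw_{4,n}-d_{n-2}e^{ik}w_{5,n-2}-b_nw_{6,n},\\ (\widehat H_{\mathrm{II}}(k)\mathbf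 w)_{3,n}&=-c_nw_{4,n+1}-b_nw_{5,n}-b_nw_{6,n},\\ (\widehat H_{\mathrm{II}}(k)\mathbf w)_{4,n}&=-b_nw_{1,n}-b_nw_{2,n}-c_{n-1}w_{3,n-1},\\ (\widehat H_{\mathrm{II}}(k)\mathbf w)_{5,n}&=-b_nw_{1,n}-d_ne^{-ik}w_{2,n+2}-b_nw_{3,n},\\ (\widehat H_{\mathrm{II}}(k)\mathbf w)_{6,n}&=-c_{n-1}e^{ik}w_{1,n-1}-b_nw_{2,n}-b_nw_{3,n}. \end{aligned}$$ If $\delta_+\delta_-<0$, then there is a nonzero real constant $E^{(1)}_{\mathrm{II}}$, depending only on $(b_\pm,\delta_\pm,c)$, such that for all sufficiently small nonzero $|k|$ the operator $\widehat H_{\mathrm{II}}(k)$ has two distinct real eigenvalues $E_{\mathrm{II},-}(k)$ and $E_{\mathrm{II},+}(k)$, and $$E_{\mathrm{II},\pm}(k)=\pm E^{(1)}_{\mathrm{II}}\,|k|+\mathcal O(k^2)\qquad(k\to 0,\ k\ne 0).$$ -/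

import Mathlib

open Filter Topology Asymptotics

noncomputable section

namespace TypeII

/-- The parameters `(b₊, b₋, δ₊, δ₋, c)` of the interface (data only; their signs are hypotheses
of the theorem). -/
structure Params where
  bPlus : ℝ
  bMinus : ℝ
  δPlus : ℝ
  δMinus : ℝ
  c : ℝ

/-- Intracell hopping coefficient `b_n`. -/
def hopB (p : Params) (n : ℤ) : ℝ :=
  if 0 ≤ n then p.bPlus else p.bMinus

/-- Intercell hopping coefficient `c_n` (joining cells `n` and `n + 1`). -/
def hopC (p : Params) (n : ℤ) : ℝ :=
  if 0 ≤ n then p.bPlus + p.δPlus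
  else if n = -1 then p.c
  else p.bMinus + p.δMinus

/-- Intercell hopping coefficient `d_n` (joining cells `n` and `n + 2`). -/
def hopD (p : Params) (n : ℤ) : ℝ :=
  if 0 ≤ n then p.bPlus + p.δPlus
  else if n = -1 ∨ n = -2 then p.c
  else p.bMinus + p.δMinus

/-- The Hilbert space `ℓ²(ℤ; ℂ⁶)`; the components `1, …, 6` are indexed by `0, …, 5`.
A sequence `φ` stands for the `k`-quasiperiodic wave function `ψ_{j,m,n} = e^{ikm} φ_{j,n}`. -/
abbrev Space : Type :=
  lp (fun _ : ℤ => EuclideanSpace ℂ (Fin 6)) 2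

/-- `e^{ik}`. -/
def phase (k : ℝ) : ℂ := Complex.exp (Complex.I * k)

/-- The Bloch Hamiltonian of the type-II interface as a difference expression. -/
def hamFun (p : Params) (k : ℝ) (w : ℤ → EuclideanSpace ℂ (Fin 6)) (n : ℤ) :
    EuclideanSpace ℂ (Fin 6) :=
  !₂[-(hopB p n : ℂ) * w n 3 - (hopB p n : ℂ) * w n 4
        - (hopC p n : ℂ) * phase (-k) * w (n + 1) 5,
     -(hopB p n : ℂ) * w n 3 - (hopD p (n - 2) : ℂ) * phase k * w (n - 2) 4
        - (hopB p n : ℂ) * w n 5,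
     -(hopC p n : ℂ) * w (n + 1) 3 - (hopB p n : ℂ) * w n 4 - (hopB p n : ℂ) * w n 5,
     -(hopB p n : ℂ) * w n 0 - (hopB p n : ℂ) * w n 1
        - (hopC p (n - 1) : ℂ) * w (n - 1) 2,
     -(hopB p n : ℂ) * w n 0 - (hopD p n : ℂ) * phase (-k) * w (n + 2) 1
        - (hopB p n : ℂ) * w n 2,
     -(hopC p (n - 1) : ℂ) * phase k * w (n - 1) 0 - (hopB p n : ℂ) * w n 1
        - (hopB p n : ℂ) * w n 2]

theorem memℓp_iff_coord (w : ℤ → EuclideanSpace ℂ (Fin 6)) :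
    Memℓp w 2 ↔ ∀ j, Memℓp (fun n => w n j) 2 := by
  have h2 : (0 : ℝ) < (2 : ENNReal).toReal := by norm_num
  simp only [memℓp_gen_iff h2]
  norm_num
  constructor
  · intro h j
    refine h.of_nonneg_of_le (fun n => by positivity) (fun n => ?_)
    have := PiLp.norm_apply_le (w n) j
    gcongr
  · intro h
    simp only [EuclideanSpace.norm_sq_eq]
    exact summable_sum fun j _ => h j

theorem memℓp_shift {f : ℤ → ℂ} (hf : Memℓp f 2) (m : ℤ) :
    Memℓp (fun n => f (n + m)) 2 := by
  have h2 : (0 : ℝ) < (2 : ENNReal).toReal := by norm_num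
  rw [memℓp_gen_iff h2] at hf ⊢
  exact (Equiv.addRight m).summable_iff.mpr hf

theorem memℓp_bdd_mul {f : ℤ → ℂ} (hf : Memℓp f 2) (a : ℤ → ℂ) (K : ℝ)
    (ha : ∀ n, ‖a n‖ ≤ K) : Memℓp (fun n => a n * f n) 2 := by
  have h2 : (0 : ℝ) < (2 : ENNReal).toReal := by norm_num
  rw [memℓp_gen_iff h2] at hf ⊢
  norm_num at hf ⊢
  refine (hf.mul_left (K ^ 2)).of_nonneg_of_le (fun n => by positivity) (fun n => ?_)
  rw [mul_pow]
  have := ha n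
  gcongr

theorem phase_norm (k : ℝ) : ‖phase k‖ = 1 := by
  rw [phase, mul_comm, Complex.norm_exp_ofReal_mul_I]

/-- A common bound for all hopping coefficients. -/
def hopBound (p : Params) : ℝ :=
  |p.bPlus| + |p.bMinus| + |p.bPlus + p.δPlus| + |p.bMinus + p.δMinus| + |p.c|

theorem hopB_norm (p : Params) (n : ℤ) : ‖-(hopB p n : ℂ)‖ ≤ hopBound p := by
  rw [norm_neg, Complex.norm_real, Real.norm_eq_abs, hopB, hopBound]
  split_ifs <;>
  linarith [abs_nonneg p.bPlus, abs_nonneg p.bMinus, abs_nonneg (p.bPlus + p.δPlus),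
    abs_nonneg (p.bMinus + p.δMinus), abs_nonneg p.c]

theorem hopC_norm (p : Params) (n : ℤ) : ‖-(hopC p n : ℂ)‖ ≤ hopBound p := by
  rw [norm_neg, Complex.norm_real, Real.norm_eq_abs, hopC, hopBound]
  split_ifs <;>
  linarith [abs_nonneg p.bPlus, abs_nonneg p.bMinus, abs_nonneg (p.bPlus + p.δPlus),
    abs_nonneg (p.bMinus + p.δMinus), abs_nonneg p.c]

theorem hopD_norm (p : Params) (n : ℤ) : ‖-(hopD p n : ℂ)‖ ≤ hopBound p := by
  rw [norm_neg, Complex.norm_real, Real.norm_eq_abs, hopD, hopBound]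
  split_ifs <;>
  linarith [abs_nonneg p.bPlus, abs_nonneg p.bMinus, abs_nonneg (p.bPlus + p.δPlus),
    abs_nonneg (p.bMinus + p.δMinus), abs_nonneg p.c]

theorem hamFun_memℓp (p : Params) (k : ℝ) {w : ℤ → EuclideanSpace ℂ (Fin 6)}
    (hw : Memℓp w 2) : Memℓp (hamFun p k w) 2 := by
  have hc := (memℓp_iff_coord w).1 hw
  have hB : ∀ j, Memℓp (fun n => -(hopB p n : ℂ) * w n j) 2 := fun j =>
    memℓp_bdd_mul (hc j) _ _ (hopB_norm p)
  have hC : ∀ (j : Fin 6) (m l : ℤ) (z : ℂ), ‖z‖ = 1 →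
      Memℓp (fun n => (-(hopC p (n + l) : ℂ) * z) * w (n + m) j) 2 := fun j m l z hz =>
    memℓp_bdd_mul (memℓp_shift (hc j) m) _ (hopBound p) fun n => by
      rw [norm_mul, hz, mul_one]; exact hopC_norm p _
  have hD : ∀ (j : Fin 6) (m l : ℤ) (z : ℂ), ‖z‖ = 1 →
      Memℓp (fun n => (-(hopD p (n + l) : ℂ) * z) * w (n + m) j) 2 := fun j m l z hz =>
    memℓp_bdd_mul (memℓp_shift (hc j) m) _ (hopBound p) fun n => by
      rw [norm_mul, hz, mul_one]; exact hopD_norm p _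
  have h1 : ‖(1 : ℂ)‖ = 1 := norm_one
  rw [memℓp_iff_coord]
  intro j
  fin_cases j
  · convert ((hB 3).add (hB 4)).add (hC 5 1 0 _ (phase_norm (-k))) using 1
    funext n; simp [hamFun]; ring
  · convert ((hB 3).add (hD 4 (-2) (-2) _ (phase_norm k))).add (hB 5) using 1
    funext n; simp [hamFun, sub_eq_add_neg]
  · convert ((hC 3 1 0 1 h1).add (hB 4)).add (hB 5) using 1
    funext n; simp [hamFun]; ring
  · convert ((hB 0).add (hB 1)).add (hC 2 (-1) (-1) 1 h1) using 1
    funext n; simp [hamFun, sub_eq_add_neg]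
  · convert ((hB 0).add (hD 1 2 0 _ (phase_norm (-k)))).add (hB 2) using 1
    funext n; simp [hamFun]; ring
  · convert ((hC 0 (-1) (-1) _ (phase_norm k)).add (hB 1)).add (hB 2) using 1
    funext n; simp [hamFun, sub_eq_add_neg]

/-- The Bloch Hamiltonian `Ĥ_II(k)` of the type-II interface, acting on `ℓ²(ℤ; ℂ⁶)`. -/
def ham (p : Params) (k : ℝ) : Module.End ℂ Space where
  toFun w := ⟨hamFun p k w, hamFun_memℓp p k (lp.memℓp w)⟩
  map_add' u w := by
    ext n j
    change hamFun p k (⇑u + ⇑w) n j = hamFun p k u n j + hamFun p k w n j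
    fin_cases j <;> simp [hamFun] <;> ring
  map_smul' a w := by
    ext n j
    change hamFun p k (a • ⇑w) n j = a * hamFun p k w n j
    fin_cases j <;> simp [hamFun] <;> ring

end TypeII

end

/-! At `k = 0` the operator has a two-dimensional kernel at an isolated point of its spectrum, and
first-order degenerate perturbation theory splits it linearly.

The lattice is bipartite: components `0,1,2` couple only to `3,4,5`. At `k = 0` each sublattice
decouples further into sums and differences of its two outer components, which gives four scalar
recurrences: first order for differences, second order for sums once the middle component is
eliminated. In the bulk the characteristic roots are real and avoid `±1` because `δ ≠ 0`, so zero is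
outside the essential spectrum; `hamCLM_zero_coercive` expresses this as coercivity modulo four
cells. If `δ₊ > 0 > δ₋`, comparing growth on the two half-lines leaves exactly one mode `U`
(symmetric, first sublattice) and one mode `V` (antisymmetric, second sublattice), both with
positive profiles.

The derivative of the Hamiltonian in `k` exchanges the sublattices, so on the kernel it is a purely
off-diagonal `2 × 2` matrix. By `exists_inner_modes` its entry is a sum of terms of one sign and
cannot cancel; hence the slopes are `±μ` with `μ ≠ 0`. `exists_eigenvalue_near_of_first_order` turns
the slope `μ` into a genuine eigenvalue `μ k + O(k²)`. The chiral symmetry `E ↦ -E` supplies the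
other branch, and reflection about the interface supplies the opposite signs of `δ±`. -/

section Perturbation

/-! ### Perturbation of a zero eigenvalue of a self-adjoint operator. -/

variable {𝓗 F : Type*} [NormedAddCommGroup 𝓗] [InnerProductSpace ℂ 𝓗] [CompleteSpace 𝓗]
  [NormedAddCommGroup F] [NormedSpace ℂ F] [FiniteDimensional ℂ F]

/-- An injective operator that is bounded below modulo a finite-rank operator is bounded below. -/
theorem exists_bounded_below_of_injective (A : 𝓗 →L[ℂ] 𝓗) (K : 𝓗 →L[ℂ] F) (C : ℝ)
    (hC : ∀ w, ‖w‖ ≤ C * (‖A w‖ + ‖K w‖)) (hA : ∀ w, A w = 0 → w = 0) :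
    ∃ c : ℝ, 0 < c ∧ ∀ w, c * ‖w‖ ≤ ‖A w‖ := by
  by_contra! hcon
  have hprop : ProperSpace F := FiniteDimensional.proper ℂ F
  have hw : ∀ j : ℕ, ∃ w : 𝓗, ‖w‖ = 1 ∧ ‖A w‖ < 1 / ((j : ℝ) + 1) := by
    intro j
    obtain ⟨w, hw⟩ := hcon (1 / ((j : ℝ) + 1)) (by positivity)
    have hw0 : w ≠ 0 := by rintro rfl; simp at hw
    have hpos : 0 < ‖w‖ := norm_pos_iff.2 hw0
    refine ⟨((‖w‖⁻¹ : ℝ) : ℂ) • w, ?_, ?_⟩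
    · rw [norm_smul, Complex.norm_real, norm_inv, norm_norm, inv_mul_cancel₀ hpos.ne']
    · rw [map_smul, norm_smul, Complex.norm_real, norm_inv, norm_norm, inv_mul_lt_iff₀ hpos]
      linarith [mul_comm ‖w‖ (1 / ((j : ℝ) + 1))]
  choose w hw1 hwA using hw
  have hA0 : Tendsto (fun j => A (w j)) atTop (𝓝 0) :=
    squeeze_zero_norm (fun j => (hwA j).le) tendsto_one_div_add_atTop_nhds_zero_nat
  -- Along unit vectors with `A (w j) → 0`, compactness in the finite-dimensional `F` makes `K (w
  -- j)` converge on a subsequence; `hC` then makes that subsequence Cauchy, and its limit is a unit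
  -- vector in the kernel.
  obtain ⟨y, -, φ, hφ, hy⟩ := tendsto_subseq_of_bounded (x := fun j => K (w j))
    (Metric.isBounded_closedBall (x := (0 : F)) (r := ‖K‖)) (fun j => by
      rw [mem_closedBall_zero_iff]
      simpa [hw1 j] using K.le_opNorm (w j))
  have hAφ := hA0.comp hφ.tendsto_atTop
  have hcauchy : CauchySeq (w ∘ φ) := by
    have h1 := hAφ.cauchySeq
    have h2 := hy.cauchySeq
    rw [Metric.cauchySeq_iff] at h1 h2 ⊢
    intro ε hε
    obtain ⟨N1, hN1⟩ := h1 (ε / (2 * (|C| + 1))) (by positivity)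
    obtain ⟨N2, hN2⟩ := h2 (ε / (2 * (|C| + 1))) (by positivity)
    refine ⟨max N1 N2, fun m hm n hn => ?_⟩
    have a1 := hN1 m (le_of_max_le_left hm) n (le_of_max_le_left hn)
    have a2 := hN2 m (le_of_max_le_right hm) n (le_of_max_le_right hn)
    simp only [Function.comp, dist_eq_norm, ← map_sub] at a1 a2 ⊢
    have h3 := hC (w (φ m) - w (φ n))
    have h4 : C * (‖A (w (φ m) - w (φ n))‖ + ‖K (w (φ m) - w (φ n))‖) ≤
        |C| * (‖A (w (φ m) - w (φ n))‖ + ‖K (w (φ m) - w (φ n))‖) :=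
      mul_le_mul_of_nonneg_right (le_abs_self C) (by positivity)
    have h5 : |C| * (‖A (w (φ m) - w (φ n))‖ + ‖K (w (φ m) - w (φ n))‖) ≤
        |C| * (ε / (2 * (|C| + 1)) + ε / (2 * (|C| + 1))) := by gcongr
    have h6 : |C| * (ε / (2 * (|C| + 1)) + ε / (2 * (|C| + 1))) < ε := by
      rw [← add_div, ← two_mul, mul_div_mul_left _ _ two_ne_zero, mul_div_assoc',
        div_lt_iff₀ (by positivity)]
      nlinarith [abs_nonneg C]
    linarith
  obtain ⟨v, hv⟩ := cauchySeq_tendsto_of_complete hcauchy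
  have hv1 : ‖v‖ = 1 := by
    refine tendsto_nhds_unique hv.norm ?_
    simp [hw1]
  have hAv : A v = 0 :=
    tendsto_nhds_unique ((A.continuous.tendsto v).comp hv) hAφ
  rw [hA v hAv] at hv1
  simp at hv1

/-- A lower bound gives injectivity and closed range; self-adjointness identifies the orthogonal
complement of the range with the kernel, which is trivial, so the range is also dense. -/
theorem IsSelfAdjoint.isUnit_of_bounded_below {A : 𝓗 →L[ℂ] 𝓗} (hA : IsSelfAdjoint A) {c : ℝ}
    (hc : 0 < c) (h : ∀ w, c * ‖w‖ ≤ ‖A w‖) : IsUnit A := by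
  rw [ContinuousLinearMap.isUnit_iff_bijective,
    ContinuousLinearMap.bijective_iff_dense_range_and_antilipschitz]
  refine ⟨?_, ⟨c.toNNReal⁻¹, ?_⟩⟩
  · rw [Submodule.topologicalClosure_eq_top_iff, Submodule.eq_bot_iff]
    intro x hx
    have h0 : A x = 0 := by
      rw [← inner_self_eq_zero (𝕜 := ℂ)]
      have := hx (A (A x)) ⟨A x, rfl⟩
      exact (ContinuousLinearMap.isSelfAdjoint_iff_isSymmetric.1 hA (A x) x).symm.trans this
    have := h x
    rw [h0, norm_zero] at this
    exact norm_le_zero_iff.1 (by nlinarith)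
  · refine ContinuousLinearMap.antilipschitz_of_bound A fun x => ?_
    have := h x
    rw [NNReal.coe_inv, Real.coe_toNNReal c hc.le, ← div_eq_inv_mul, le_div_iff₀ hc]
    linarith

/-- A self-adjoint operator with an approximate kernel vector has spectrum close to zero. -/
theorem IsSelfAdjoint.exists_mem_spectrum_of_norm_le {A : 𝓗 →L[ℂ] 𝓗} (hA : IsSelfAdjoint A)
    {ε : ℝ} {w : 𝓗} (hw : w ≠ 0) (h : ‖A w‖ ≤ ε * ‖w‖) :
    ∃ e : ℝ, |e| ≤ ε ∧ (e : ℂ) ∈ spectrum ℂ A := by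
  have hwpos : 0 < ‖w‖ := norm_pos_iff.2 hw
  have : Nontrivial 𝓗 := ⟨⟨w, 0, hw⟩⟩
  have hε : 0 ≤ ε := by
    by_contra! hneg
    nlinarith [norm_nonneg (A w)]
  by_cases hu : IsUnit A
  · obtain ⟨u, rfl⟩ := hu
    have hB : IsSelfAdjoint (↑u⁻¹ : 𝓗 →L[ℂ] 𝓗) := by
      have : star u = u := Units.ext hA
      rw [IsSelfAdjoint, ← Units.coe_star, star_inv, this]
    -- The self-adjoint inverse attains its norm at a spectral point `z`, so `z⁻¹` lies in the
    -- spectrum of the operator at distance `1 / ‖u⁻¹‖ ≤ ε` from zero.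
    obtain ⟨z, hz, hzr⟩ := spectrum.exists_nnnorm_eq_spectralRadius (↑u⁻¹ : 𝓗 →L[ℂ] 𝓗)
    rw [hB.spectralRadius_eq_nnnorm, ENNReal.coe_inj] at hzr
    have hzn : ‖z‖ = ‖(↑u⁻¹ : 𝓗 →L[ℂ] 𝓗)‖ := congrArg NNReal.toReal hzr
    have hz0 : z ≠ 0 := spectrum.ne_zero_of_mem_of_unit hz
    have hzs : z⁻¹ ∈ spectrum ℂ (↑u : 𝓗 →L[ℂ] 𝓗) := by
      have := (spectrum.inv_mem_iff (r := (Units.mk0 z hz0)) (a := u⁻¹)).1 (by simpa using hz)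
      simpa using this
    have hre := hA.mem_spectrum_eq_re hzs
    refine ⟨(z⁻¹).re, ?_, by rwa [← hre]⟩
    have hab : |(z⁻¹).re| = ‖z‖⁻¹ := by
      rw [← Real.norm_eq_abs, ← Complex.norm_real, ← hre, norm_inv]
    have hBA : (↑u⁻¹ : 𝓗 →L[ℂ] 𝓗) ((↑u : 𝓗 →L[ℂ] 𝓗) w) = w := by
      rw [← mul_apply_eq_comp, Units.inv_mul, one_apply_eq_self]
    have hle := (↑u⁻¹ : 𝓗 →L[ℂ] 𝓗).le_opNorm ((↑u : 𝓗 →L[ℂ] 𝓗) w)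
    rw [hBA, ← hzn] at hle
    have hzpos : 0 < ‖z‖ := norm_pos_iff.2 hz0
    have h2 : ‖w‖ ≤ ‖z‖ * (ε * ‖w‖) := hle.trans (by gcongr)
    rw [hab, inv_le_iff_one_le_mul₀ hzpos]
    nlinarith
  · refine ⟨0, by simpa using hε, ?_⟩
    rw [Complex.ofReal_zero, spectrum.zero_mem_iff]
    exact hu

/-- First-order perturbation of a zero eigenvalue outside the essential spectrum. -/
theorem exists_eigenvalue_near_of_first_order (H : ℝ → 𝓗 →L[ℂ] 𝓗) (H₁ : 𝓗 →L[ℂ] 𝓗)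
    (hsa : ∀ k, IsSelfAdjoint (H k)) (B : ℝ) (hB : ∀ k, ‖H k - H 0 - (k : ℂ) • H₁‖ ≤ B * k ^ 2)
    (K : 𝓗 →L[ℂ] F) (C : ℝ) (hC : ∀ w, ‖w‖ ≤ C * (‖H 0 w‖ + ‖K w‖))
    (μ : ℝ) (w₀ : 𝓗) (hw₀ : w₀ ≠ 0) (hker : H 0 w₀ = 0)
    (hperp : ∀ z, H 0 z = 0 → inner ℂ z (H₁ w₀ - (μ : ℂ) • w₀) = 0) :
    ∃ D : ℝ, ∀ᶠ k in 𝓝 (0 : ℝ), ∃ e : ℝ,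
      Module.End.HasEigenvalue (H k : 𝓗 →ₗ[ℂ] 𝓗) (e : ℂ) ∧ |e - μ * k| ≤ D * k ^ 2 := by
  have hsym : ∀ x y, inner ℂ (H 0 x) y = inner ℂ x (H 0 y) :=
    ContinuousLinearMap.isSelfAdjoint_iff_isSymmetric.1 (hsa 0)
  let N : Submodule ℂ 𝓗 := LinearMap.ker (H 0 : 𝓗 →ₗ[ℂ] 𝓗)
  have hNmem : ∀ z, z ∈ N ↔ H 0 z = 0 := fun z => LinearMap.mem_ker
  have hNclosed : IsClosed (N : Set 𝓗) := ContinuousLinearMap.isClosed_ker (H 0)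
  have : CompleteSpace N := hNclosed.completeSpace_coe
  let P : 𝓗 →L[ℂ] 𝓗 := N.starProjection
  have hPN : ∀ w, H 0 (P w) = 0 := fun w => (hNmem _).1 (N.starProjection_apply_mem w)
  have hrange : ∀ w, H 0 w ∈ Nᗮ := fun w => by
    rw [Submodule.mem_orthogonal]
    intro z hz
    rw [← hsym, (hNmem z).1 hz, inner_zero_left]
  have hP0 : ∀ w ∈ Nᗮ, P w = 0 := fun w hw => by
    rwa [Submodule.starProjection_apply_eq_zero_iff]
  have hPP : ∀ w, P (P w) = P w := fun w =>
    Submodule.starProjection_eq_self_iff.2 (N.starProjection_apply_mem w)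
  -- `H 0 w` and `P w` are orthogonal, so adding the kernel projection loses no coercivity; it only
  -- removes the kernel and makes the operator invertible.
  have hle : ∀ w, ‖H 0 w‖ ≤ ‖(H 0 + P) w‖ := fun w => by
    have h0 : inner ℂ (H 0 w) (P w) = 0 := by rw [hsym, hPN, inner_zero_right]
    have h1 := norm_add_sq_eq_norm_sq_add_norm_sq_of_inner_eq_zero _ _ h0
    rw [add_apply]
    refine le_of_sq_le_sq ?_ (norm_nonneg _)
    nlinarith [norm_nonneg (P w)]
  have hAinj : ∀ w, (H 0 + P) w = 0 → w = 0 := fun w hw => by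
    have h0 : H 0 w = 0 := norm_le_zero_iff.1 ((hle w).trans (by rw [hw, norm_zero]))
    have h1 : P w = w := Submodule.starProjection_eq_self_iff.2 ((hNmem w).2 h0)
    rw [add_apply, h0, zero_add, h1] at hw
    exact hw
  have hCabs : ∀ w, ‖w‖ ≤ |C| * (‖H 0 w‖ + ‖K w‖) := fun w =>
    (hC w).trans (mul_le_mul_of_nonneg_right (le_abs_self C) (by positivity))
  obtain ⟨c, hc, hcA⟩ := exists_bounded_below_of_injective (H 0 + P) K |C|
    (fun w => (hCabs w).trans (by gcongr; exact hle w)) hAinj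
  have hAunit : IsUnit (H 0 + P) :=
    ((hsa 0).add (isSelfAdjoint_starProjection N)).isUnit_of_bounded_below hc hcA
  -- First-order corrector: `hperp` puts the right-hand side in the orthogonal complement of the
  -- kernel, so the solution has no kernel part and solves `H 0 w₁ = -(H₁ - μ) w₀`.
  obtain ⟨w₁, hw₁⟩ := (ContinuousLinearMap.isUnit_iff_bijective.1 hAunit).2
    (-(H₁ w₀ - (μ : ℂ) • w₀))
  have hPw₁ : P w₁ = 0 := by
    have h1 : P ((H 0 + P) w₁) = P w₁ := by
      rw [add_apply, map_add, hPP, hP0 _ (hrange w₁), zero_add]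
    rw [← h1, hw₁]
    refine hP0 _ (Submodule.neg_mem _ ?_)
    rw [Submodule.mem_orthogonal]
    exact fun z hz => hperp z ((hNmem z).1 hz)
  have hcorr : H 0 w₁ = -(H₁ w₀ - (μ : ℂ) • w₀) := by
    rw [← hw₁, add_apply, hPw₁, add_zero]
  have hw₀pos : 0 < ‖w₀‖ := norm_pos_iff.2 hw₀
  set M : ℝ := ‖H₁ w₁ - (μ : ℂ) • w₁‖ with hM
  -- The residual of `w₀ + k w₁` at `μ k` is at most `k² (B ‖q‖ + M)`; the factor `2 / ‖w₀‖` comes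
  -- from `‖q‖ ≥ ‖w₀‖ / 2`.
  set D : ℝ := B + 2 * M / ‖w₀‖ with hD
  refine ⟨D, ?_⟩
  have hsmall₁ : ∀ᶠ k in 𝓝 (0 : ℝ), |k| * ‖w₁‖ < ‖w₀‖ / 2 := by
    have : Tendsto (fun k : ℝ => |k| * ‖w₁‖) (𝓝 0) (𝓝 (|0| * ‖w₁‖)) :=
      (by fun_prop : Continuous fun k : ℝ => |k| * ‖w₁‖).tendsto 0
    rw [abs_zero, zero_mul] at this
    exact this.eventually_lt_const (by positivity)
  have hsmall₂ : ∀ᶠ k in 𝓝 (0 : ℝ),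
      |C| * (B * k ^ 2 + |k| * ‖H₁‖ + (|μ| * |k| + D * k ^ 2)) < 1 / 2 := by
    have : Tendsto (fun k : ℝ => |C| * (B * k ^ 2 + |k| * ‖H₁‖ + (|μ| * |k| + D * k ^ 2)))
        (𝓝 0) (𝓝 (|C| * (B * 0 ^ 2 + |0| * ‖H₁‖ + (|μ| * |0| + D * 0 ^ 2)))) :=
      (by fun_prop : Continuous fun k : ℝ =>
        |C| * (B * k ^ 2 + |k| * ‖H₁‖ + (|μ| * |k| + D * k ^ 2))).tendsto 0
    refine this.eventually_lt_const ?_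
    norm_num
  filter_upwards [hsmall₁, hsmall₂] with k hk₁ hk₂
  set q : 𝓗 := w₀ + (k : ℂ) • w₁ with hq
  have hqlow : ‖w₀‖ / 2 ≤ ‖q‖ := by
    have h1 := norm_sub_le_norm_add w₀ ((k : ℂ) • w₁)
    rw [norm_smul, Complex.norm_real, Real.norm_eq_abs] at h1
    linarith
  have hq0 : q ≠ 0 := norm_pos_iff.1 (by linarith)
  have hqeq : (H k - ((μ * k : ℝ) : ℂ) • (1 : 𝓗 →L[ℂ] 𝓗)) q =
      (H k - H 0 - (k : ℂ) • H₁) q + ((k : ℂ) ^ 2) • (H₁ w₁ - (μ : ℂ) • w₁) := by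
    simp only [hq, sub_apply, smul_apply, map_add,
      map_smul, hker, hcorr, one_apply_eq_self, Complex.ofReal_mul]
    module
  have hquasi : ‖(H k - ((μ * k : ℝ) : ℂ) • (1 : 𝓗 →L[ℂ] 𝓗)) q‖ ≤ (D * k ^ 2) * ‖q‖ := by
    rw [hqeq]
    refine (norm_add_le _ _).trans ?_
    rw [norm_smul, norm_pow, Complex.norm_real, Real.norm_eq_abs, sq_abs, ← hM]
    have h1 := ((H k - H 0 - (k : ℂ) • H₁).le_opNorm q).trans
      (mul_le_mul_of_nonneg_right (hB k) (norm_nonneg q))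
    have h2 : M ≤ 2 * M / ‖w₀‖ * ‖q‖ := by
      rw [div_mul_eq_mul_div, le_div_iff₀ hw₀pos]
      nlinarith [norm_nonneg (H₁ w₁ - (μ : ℂ) • w₁)]
    have h3 := mul_le_mul_of_nonneg_left h2 (sq_nonneg k)
    rw [hD]
    linarith
  have hsaR : ∀ r : ℝ, IsSelfAdjoint (H k - (r : ℂ) • (1 : 𝓗 →L[ℂ] 𝓗)) := fun r =>
    (hsa k).sub (IsSelfAdjoint.smul (by simp [IsSelfAdjoint]) (IsSelfAdjoint.one _))
  obtain ⟨e, he, hspec⟩ := (hsaR (μ * k)).exists_mem_spectrum_of_norm_le hq0 hquasi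
  refine ⟨μ * k + e, ?_, by rwa [add_sub_cancel_left]⟩
  set G : 𝓗 →L[ℂ] 𝓗 := H k - ((μ * k + e : ℝ) : ℂ) • (1 : 𝓗 →L[ℂ] 𝓗) with hG
  have hGunit : ¬ IsUnit G := by
    rw [spectrum.mem_iff] at hspec
    intro hu
    apply hspec
    convert hu.neg using 1
    rw [hG, Algebra.algebraMap_eq_smul_one, Complex.ofReal_add]
    module
  -- For small `k` the perturbation is absorbed by the coercivity of `H 0`, at the cost of doubling
  -- the constant. A spectral point this close to zero must then be an eigenvalue: an injective `G`
  -- would be invertible.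
  have hGcoer : ∀ w, ‖w‖ ≤ (2 * |C|) * (‖G w‖ + ‖K w‖) := fun w => by
    have h1 : H 0 w = G w - (H k - H 0 - (k : ℂ) • H₁) w - (k : ℂ) • H₁ w
        + ((μ * k + e : ℝ) : ℂ) • w := by
      simp only [hG, sub_apply, smul_apply,
        one_apply_eq_self]
      module
    have h2 : ‖H 0 w‖ ≤ ‖G w‖ + B * k ^ 2 * ‖w‖ + |k| * (‖H₁‖ * ‖w‖)
        + (|μ| * |k| + D * k ^ 2) * ‖w‖ := by
      rw [h1]
      refine (norm_add_le _ _).trans (add_le_add ((norm_sub_le _ _).trans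
        (add_le_add ((norm_sub_le _ _).trans (add_le_add le_rfl ?_)) ?_)) ?_)
      · exact ((H k - H 0 - (k : ℂ) • H₁).le_opNorm w).trans
          (mul_le_mul_of_nonneg_right (hB k) (norm_nonneg w))
      · rw [norm_smul, Complex.norm_real, Real.norm_eq_abs]
        exact mul_le_mul_of_nonneg_left (H₁.le_opNorm w) (abs_nonneg k)
      · rw [norm_smul, Complex.norm_real, Real.norm_eq_abs]
        refine mul_le_mul_of_nonneg_right ((abs_add_le _ _).trans ?_) (norm_nonneg w)
        rw [abs_mul]
        linarith
    have h3 := hCabs w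
    have h4 := mul_le_mul_of_nonneg_left h2 (abs_nonneg C)
    have h5 := mul_le_mul_of_nonneg_right hk₂.le (norm_nonneg w)
    nlinarith
  have hnotinj : ∃ w, G w = 0 ∧ w ≠ 0 := by
    by_contra! hinj
    obtain ⟨c', hc', hb⟩ := exists_bounded_below_of_injective G K _ hGcoer hinj
    exact hGunit ((hsaR _).isUnit_of_bounded_below hc' hb)
  obtain ⟨w, hGw, hw⟩ := hnotinj
  refine Module.End.hasEigenvalue_of_hasEigenvector (x := w)
    ⟨Module.End.mem_eigenspace_iff.2 ?_, hw⟩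
  rw [hG, sub_apply, smul_apply,
    one_apply_eq_self, sub_eq_zero] at hGw
  exact hGw

end Perturbation

/-! ### Self-adjointness of the Bloch Hamiltonian. -/

noncomputable section

namespace TypeII

open ComplexConjugate

theorem memℓp_coord (w : Space) (j : Fin 6) : Memℓp (fun n => w n j) 2 :=
  (memℓp_iff_coord w).1 (lp.memℓp w) j

theorem memℓp_two_iff_summable {ι : Type*} {f : ι → ℂ} :
    Memℓp f 2 ↔ Summable fun n => ‖f n‖ ^ 2 := by
  rw [memℓp_gen_iff (by norm_num)]
  norm_num

theorem summable_coord_sq (w : Space) (j : Fin 6) : Summable fun n => ‖w n j‖ ^ 2 :=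
  memℓp_two_iff_summable.1 (memℓp_coord w j)

theorem summable_mul_of_memℓp {f g : ℤ → ℂ} (hf : Memℓp f 2) (hg : Memℓp g 2) :
    Summable fun n => f n * g n := by
  refine .of_norm_bounded ((memℓp_two_iff_summable.1 hf).add (memℓp_two_iff_summable.1 hg))
    fun n => ?_
  rw [norm_mul]
  nlinarith [sq_nonneg (‖f n‖ - ‖g n‖), sq_nonneg (‖f n‖ + ‖g n‖)]

theorem memℓp_conj {f : ℤ → ℂ} (hf : Memℓp f 2) : Memℓp (fun n => conj (f n)) 2 := by
  rw [memℓp_two_iff_summable] at hf ⊢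
  simpa using hf

theorem conj_phase (k : ℝ) : conj (phase k) = phase (-k) := by
  rw [phase, phase, ← Complex.exp_conj]
  simp

theorem hasSum_shift_sub {F : ℤ → ℂ} (hF : Summable F) (m : ℤ) :
    HasSum (fun n => F (n - m) - F n) 0 := by
  have h := ((Equiv.subRight m).hasSum_iff.2 hF.hasSum).sub hF.hasSum
  rw [sub_self] at h
  exact h

theorem summable_hop_mul {a : ℤ → ℂ} {K : ℝ} (ha : ∀ n, ‖a n‖ ≤ K) (u w : Space) (i j : Fin 6)
    (l m : ℤ) : Summable fun n => a n * (conj (u (n + l) i) * w (n + m) j) := by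
  have := summable_mul_of_memℓp
    (memℓp_bdd_mul (memℓp_conj (memℓp_shift (memℓp_coord u i) l)) a K ha)
    (memℓp_shift (memℓp_coord w j) m)
  simpa [mul_assoc] using this

theorem ham_apply (p : Params) (k : ℝ) (w : Space) (n : ℤ) : ham p k w n = hamFun p k w n := rfl

/-- The two inner products differ, cell by cell, by a discrete divergence: `F` is the current
through bonds of length one and `G` through bonds of length two, and both telescope to zero.
Symmetry on the whole space also yields boundedness (Hellinger–Toeplitz), used in `hamCLM`. -/
theorem ham_isSymmetric (p : Params) (k : ℝ) : (ham p k).IsSymmetric := by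
  intro u w
  have hC : ∀ n, ‖(hopC p n : ℂ)‖ ≤ hopBound p := fun n => by
    simpa only [norm_neg] using hopC_norm p n
  have hD : ∀ n, ‖(hopD p n : ℂ)‖ ≤ hopBound p := fun n => by
    simpa only [norm_neg] using hopD_norm p n
  let F : ℤ → ℂ := fun n =>
    ((hopC p n : ℂ) * (conj (u (n + 1) 5) * w (n + 0) 0) * phase k
      - (hopC p n : ℂ) * (conj (u (n + 0) 0) * w (n + 1) 5) * phase (-k))
    + ((hopC p n : ℂ) * (conj (u (n + 1) 3) * w (n + 0) 2)
      - (hopC p n : ℂ) * (conj (u (n + 0) 2) * w (n + 1) 3))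
  let G : ℤ → ℂ := fun n =>
    (hopD p n : ℂ) * (conj (u (n + 2) 1) * w (n + 0) 4) * phase k
      - (hopD p n : ℂ) * (conj (u (n + 0) 4) * w (n + 2) 1) * phase (-k)
  have hF : Summable F :=
    (((summable_hop_mul hC u w 5 0 1 0).mul_right _).sub
      ((summable_hop_mul hC u w 0 5 0 1).mul_right _)).add
    ((summable_hop_mul hC u w 3 2 1 0).sub (summable_hop_mul hC u w 2 3 0 1))
  have hG : Summable G :=
    ((summable_hop_mul hD u w 1 4 2 0).mul_right _).sub
      ((summable_hop_mul hD u w 4 1 0 2).mul_right _)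
  have h0 := (hasSum_shift_sub hF 1).add (hasSum_shift_sub hG 2)
  have h1 := (lp.hasSum_inner (𝕜 := ℂ) (ham p k u) w).sub
    (lp.hasSum_inner (𝕜 := ℂ) u (ham p k w))
  have hfun : ∀ n, inner ℂ (ham p k u n) (w n) - inner ℂ (u n) (ham p k w n) =
      F (n - 1) - F n + (G (n - 2) - G n) := fun n => by
    simp only [PiLp.inner_apply, ham_apply, hamFun, Fin.sum_univ_six, F, G]
    simp [conj_phase]
    ring
  simp only [hfun] at h1
  exact sub_eq_zero.1 ((h1.unique h0).trans (add_zero 0))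

/-- The Bloch Hamiltonian as a bounded operator. -/
def hamCLM (p : Params) (k : ℝ) : Space →L[ℂ] Space := (ham_isSymmetric p k).toSelfAdjoint.1

theorem hamCLM_apply (p : Params) (k : ℝ) (w : Space) (n : ℤ) :
    hamCLM p k w n = hamFun p k w n := rfl

theorem hamCLM_isSelfAdjoint (p : Params) (k : ℝ) : IsSelfAdjoint (hamCLM p k) :=
  (ham_isSymmetric p k).toSelfAdjoint.2

/-! ### Expansion in the quasi-momentum. -/

theorem phase_zero : phase 0 = 1 := by simp [phase]

theorem phase_eq (k : ℝ) : phase k = (Real.cos k : ℂ) + (Real.sin k : ℂ) * Complex.I := by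
  rw [phase, mul_comm, Complex.exp_mul_I, Complex.ofReal_cos, Complex.ofReal_sin]

/-- The derivative of the Bloch Hamiltonian at `k = 0`. -/
def hamDeriv (p : Params) : Space →L[ℂ] Space :=
  hamCLM p (Real.pi / 2) - (1 / 2 : ℂ) • (hamCLM p 0 + hamCLM p Real.pi)

theorem hamDeriv_apply (p : Params) (w : Space) (n : ℤ) : hamDeriv p w n =
    !₂[(hopC p n : ℂ) * Complex.I * w (n + 1) 5,
      -(hopD p (n - 2) : ℂ) * Complex.I * w (n - 2) 4, 0, 0,
      (hopD p n : ℂ) * Complex.I * w (n + 2) 1,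
      -(hopC p (n - 1) : ℂ) * Complex.I * w (n - 1) 0] := by
  change hamFun p (Real.pi / 2) w n - (1 / 2 : ℂ) • (hamFun p 0 w n + hamFun p Real.pi w n) = _
  ext j
  fin_cases j <;> simp [hamFun, phase_eq] <;> ring

/-- The Hamiltonian is exactly `A + cos k · X + sin k · Y`. Hence its value at `π/2` minus the mean
of its values at `0` and `π` is `Y`, the derivative at zero, and the remainder is explicit. -/
theorem hamCLM_eq (p : Params) (k : ℝ) : hamCLM p k - hamCLM p 0 - (k : ℂ) • hamDeriv p =
    ((Real.cos k - 1 : ℝ) : ℂ) • ((1 / 2 : ℂ) • (hamCLM p 0 - hamCLM p Real.pi))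
      + ((Real.sin k - k : ℝ) : ℂ) • hamDeriv p := by
  ext w n : 3
  change hamFun p k w n - hamFun p 0 w n - (k : ℂ) • hamDeriv p w n =
    ((Real.cos k - 1 : ℝ) : ℂ) • ((1 / 2 : ℂ) • (hamFun p 0 w n - hamFun p Real.pi w n))
      + ((Real.sin k - k : ℝ) : ℂ) • hamDeriv p w n
  rw [hamDeriv_apply]
  ext j
  fin_cases j <;> simp [hamFun, phase_eq] <;> ring

theorem abs_sin_sub_self_le_sq (k : ℝ) : |Real.sin k - k| ≤ 2 * k ^ 2 := by
  rcases le_or_gt |k| 1 with h | h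
  · have h1 := abs_le.1 (Real.sin_bound h)
    have h2 : |k| ^ 5 ≤ k ^ 2 := by
      rw [← sq_abs k]
      exact pow_le_pow_of_le_one (abs_nonneg k) h (by norm_num)
    have h3 : |k ^ 3| ≤ k ^ 2 := by
      rw [← sq_abs k, abs_pow]
      exact pow_le_pow_of_le_one (abs_nonneg k) h (by norm_num)
    have h4 := abs_le.1 h3
    rw [abs_le]
    constructor <;> nlinarith [sq_nonneg k]
  · have h1 : |Real.sin k - k| ≤ |Real.sin k| + |k| := abs_sub _ _
    have h2 : |Real.sin k| ≤ 1 := Real.abs_sin_le_one k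
    rw [← sq_abs k]
    nlinarith

theorem norm_hamCLM_sub_le (p : Params) : ∃ B : ℝ, ∀ k : ℝ,
    ‖hamCLM p k - hamCLM p 0 - (k : ℂ) • hamDeriv p‖ ≤ B * k ^ 2 := by
  obtain ⟨X, hX⟩ : ∃ X, X = (1 / 2 : ℂ) • (hamCLM p 0 - hamCLM p Real.pi) := ⟨_, rfl⟩
  refine ⟨‖X‖ + 2 * ‖hamDeriv p‖, fun k => ?_⟩
  rw [hamCLM_eq, ← hX]
  refine (norm_add_le _ _).trans ?_
  rw [norm_smul, norm_smul, Complex.norm_real, Complex.norm_real, Real.norm_eq_abs,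
    Real.norm_eq_abs]
  have h1 : |Real.cos k - 1| ≤ k ^ 2 := by
    rw [abs_le]
    constructor <;> nlinarith [Real.one_sub_sq_div_two_le_cos (x := k), Real.cos_le_one k,
      sq_nonneg k]
  have h2 := abs_sin_sub_self_le_sq k
  have h3 := mul_le_mul_of_nonneg_right h1 (norm_nonneg X)
  have h4 := mul_le_mul_of_nonneg_right h2 (norm_nonneg (hamDeriv p))
  linarith

/-! ### Chiral and mirror symmetries. -/

/-- A square-summable sequence assembled from its six components. -/
def ofCoord (f : Fin 6 → ℤ → ℂ) (hf : ∀ j, Memℓp (f j) 2) : Space :=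
  ⟨fun n => WithLp.toLp 2 fun j => f j n, (memℓp_iff_coord _).2 hf⟩

theorem ofCoord_apply (f : Fin 6 → ℤ → ℂ) (hf : ∀ j, Memℓp (f j) 2) (n : ℤ) (j : Fin 6) :
    ofCoord f hf n j = f j n := rfl

theorem eq_zero_of_coord {w : Space} (h : ∀ n j, w n j = 0) : w = 0 := by
  ext n j
  exact h n j

/-- The spectrum is symmetric about zero, because the lattice is bipartite. -/
theorem ham_hasEigenvalue_neg {p : Params} {k : ℝ} {e : ℂ}
    (h : Module.End.HasEigenvalue (ham p k) e) : Module.End.HasEigenvalue (ham p k) (-e) := by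
  obtain ⟨w, hw, hw0⟩ := h.exists_hasEigenvector
  rw [Module.End.mem_eigenspace_iff] at hw
  -- Changing the sign on one sublattice anticommutes with the Hamiltonian.
  have hmem : ∀ j, Memℓp (fun n => (![1, 1, 1, -1, -1, -1] j : ℂ) * w n j) 2 := fun j =>
    memℓp_bdd_mul (memℓp_coord w j) _ 1 fun n => by fin_cases j <;> simp
  refine Module.End.hasEigenvalue_of_hasEigenvector (x := ofCoord _ hmem)
    ⟨Module.End.mem_eigenspace_iff.2 ?_, fun h0 => hw0 (eq_zero_of_coord fun n j => ?_)⟩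
  · ext n j
    have hn : ∀ j, hamFun p k w n j = e * w n j := fun j =>
      congrArg (fun v : Space => v n j) hw
    have hj := hn j
    change hamFun p k (ofCoord _ hmem) n j = -e * ofCoord _ hmem n j
    fin_cases j <;> simp [hamFun, ofCoord_apply] at hj ⊢ <;> first | linear_combination hj | linear_combination -hj
  · have := congrArg (fun v : Space => v n j) h0
    simp only [ofCoord_apply] at this
    fin_cases j <;> simpa using this

/-- The parameters of the interface reflected about its centre. -/
def Params.mirror (p : Params) : Params := ⟨p.bMinus, p.bPlus, p.δMinus, p.δPlus, p.c⟩

theorem hopB_mirror (p : Params) (n : ℤ) : hopB p.mirror (-1 - n) = hopB p n := by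
  simp only [hopB, Params.mirror]
  split_ifs <;> first | rfl | omega

theorem hopC_mirror (p : Params) (n : ℤ) : hopC p.mirror (-2 - n) = hopC p n := by
  simp only [hopC, Params.mirror]
  split_ifs <;> first | rfl | omega

theorem hopD_mirror (p : Params) (n : ℤ) : hopD p.mirror (-3 - n) = hopD p n := by
  simp only [hopD, Params.mirror]
  split_ifs <;> first | rfl | omega

theorem memℓp_mirror (w : Space) (j : Fin 6) : Memℓp (fun n : ℤ => w (-1 - n) j.rev) 2 := by
  have := (Equiv.subLeft (-1 : ℤ)).summable_iff.2 (summable_coord_sq w j.rev)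
  exact memℓp_two_iff_summable.2 this

/-- Reflection of a sequence about the centre of the interface, exchanging the two sublattices. -/
def mirror (w : Space) : Space := ofCoord (fun j n => w (-1 - n) j.rev) (memℓp_mirror w)

theorem mirror_apply (w : Space) (n : ℤ) (j : Fin 6) : mirror w n j = w (-1 - n) j.rev := rfl

/-- Reflection `n ↦ -1 - n` with component reversal `j ↦ j.rev` maps bonds to bonds and reverses the
phase, hence `-k`. -/
theorem ham_mirror (p : Params) (k : ℝ) (w : Space) :
    ham p.mirror (-k) (mirror w) = mirror (ham p k w) := by
  ext n j
  change hamFun p.mirror (-k) (mirror w) n j = hamFun p k w (-1 - n) j.rev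
  have hB := hopB_mirror p (-1 - n)
  have hC := hopC_mirror p (-1 - n)
  have hC' := hopC_mirror p (-1 - n - 1)
  have hD := hopD_mirror p (-1 - n)
  have hD' := hopD_mirror p (-1 - n - 2)
  have e1 : -1 - (n + 1) = -1 - n - 1 := by ring
  have e2 : -1 - (n - 1) = -1 - n + 1 := by ring
  have e3 : -1 - (n + 2) = -1 - n - 2 := by ring
  have e4 : -1 - (n - 2) = -1 - n + 2 := by ring
  rw [show -1 - (-1 - n) = n by ring] at hB
  rw [show -2 - (-1 - n) = n - 1 by ring] at hC
  rw [show -2 - (-1 - n - 1) = n by ring] at hC'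
  rw [show -3 - (-1 - n) = n - 2 by ring] at hD
  rw [show -3 - (-1 - n - 2) = n by ring] at hD'
  fin_cases j <;> simp [hamFun, mirror_apply, hB, hC, hC', hD, hD', e1, e2, e3, e4, Fin.rev] <;>
    ring

theorem mirror_eq_zero {w : Space} (h : mirror w = 0) : w = 0 := by
  refine eq_zero_of_coord fun n j => ?_
  have := congrArg (fun v : Space => v (-1 - n) j.rev) h
  simpa [mirror_apply] using this

theorem ham_hasEigenvalue_mirror {p : Params} {k : ℝ} {e : ℂ}
    (h : Module.End.HasEigenvalue (ham p.mirror (-k)) e) :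
    Module.End.HasEigenvalue (ham p k) e := by
  obtain ⟨w, hw, hw0⟩ := h.exists_hasEigenvector
  rw [Module.End.mem_eigenspace_iff] at hw
  refine Module.End.hasEigenvalue_of_hasEigenvector (x := mirror w)
    ⟨Module.End.mem_eigenspace_iff.2 ?_, fun h0 => hw0 (mirror_eq_zero h0)⟩
  have := ham_mirror p.mirror (-k) w
  rw [neg_neg, hw] at this
  exact this

/-! ### Square-summable estimates for linear recurrences. -/

/-- Convexity of the square, with weights `q` and `1 - q` at the points `a` and `e / (1 - q)`. -/
theorem sq_le_of_le_mul_add {q a e t : ℝ} (hq0 : 0 ≤ q) (hq1 : q < 1) (ht : 0 ≤ t)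
    (h : t ≤ q * a + e) : t ^ 2 ≤ q * a ^ 2 + e ^ 2 / (1 - q) := by
  have h1 : 0 < 1 - q := by linarith
  have h2 : t ^ 2 ≤ (q * a + e) ^ 2 := pow_le_pow_left₀ ht h 2
  have h3 : q * a ^ 2 + e ^ 2 / (1 - q) - (q * a + e) ^ 2 =
      q / (1 - q) * ((1 - q) * a - e) ^ 2 := by
    field_simp
    ring
  have h4 : 0 ≤ q / (1 - q) * ((1 - q) * a - e) ^ 2 := by positivity
  linarith

theorem summable_sq_add {x y : ℕ → ℂ} (hx : Summable fun m => ‖x m‖ ^ 2)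
    (hy : Summable fun m => ‖y m‖ ^ 2) : Summable fun m => ‖x m + y m‖ ^ 2 :=
  memℓp_two_iff_summable.1 ((memℓp_two_iff_summable.2 hx).add (memℓp_two_iff_summable.2 hy))

theorem summable_sq_const_mul {x : ℕ → ℂ} (a : ℂ) (hx : Summable fun m => ‖x m‖ ^ 2) :
    Summable fun m => ‖a * x m‖ ^ 2 := by
  simpa [mul_pow] using hx.mul_left (‖a‖ ^ 2)

theorem summable_sq_shift {x : ℕ → ℂ} (l : ℕ) (hx : Summable fun m => ‖x m‖ ^ 2) :
    Summable fun m => ‖x (m + l)‖ ^ 2 :=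
  (summable_nat_add_iff (f := fun m => ‖x m‖ ^ 2) l).2 hx

/-- A square-summable sequence is controlled by its first term and the defect in a first-order
recurrence whose multiplier lies off the unit circle. -/
theorem tsum_sq_le_of_first_order {σ : ℝ} (hσ : |σ| ≠ 1) : ∃ C : ℝ, 0 ≤ C ∧
    ∀ x : ℕ → ℂ, Summable (fun m => ‖x m‖ ^ 2) →
      ∑' m, ‖x m‖ ^ 2 ≤ C * (‖x 0‖ ^ 2 + ∑' m, ‖x (m + 1) - σ * x m‖ ^ 2) := by
  have hdef : ∀ x : ℕ → ℂ, Summable (fun m => ‖x m‖ ^ 2) →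
      Summable fun m => ‖x (m + 1) - σ * x m‖ ^ 2 := fun x hx => by
    have := summable_sq_add (summable_sq_shift 1 hx) (summable_sq_const_mul (-(σ : ℂ)) hx)
    simpa [sub_eq_add_neg] using this
  rcases lt_or_gt_of_ne hσ with h | h
  · have h1 : 0 < 1 - |σ| := by linarith
    refine ⟨(1 + 1 / (1 - |σ|)) / (1 - |σ|), by positivity, fun x hx => ?_⟩
    have he := hdef x hx
    have hpt : ∀ m, ‖x (m + 1)‖ ^ 2 ≤
        |σ| * ‖x m‖ ^ 2 + ‖x (m + 1) - σ * x m‖ ^ 2 / (1 - |σ|) := fun m => by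
      refine sq_le_of_le_mul_add (abs_nonneg σ) h (norm_nonneg _) ?_
      have := norm_add_le ((σ : ℂ) * x m) (x (m + 1) - σ * x m)
      rwa [add_sub_cancel, norm_mul, Complex.norm_real, Real.norm_eq_abs] at this
    have hsum := (summable_sq_shift 1 hx).tsum_le_tsum hpt
      ((hx.mul_left _).add (he.div_const _))
    rw [(hx.mul_left _).tsum_add (he.div_const _), tsum_mul_left, tsum_div_const] at hsum
    have hsplit := hx.tsum_eq_zero_add
    have hE : 0 ≤ ∑' m, ‖x (m + 1) - σ * x m‖ ^ 2 := tsum_nonneg fun m => by positivity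
    rw [div_mul_eq_mul_div, le_div_iff₀ h1]
    have : 0 ≤ 1 / (1 - |σ|) * ‖x 0‖ ^ 2 := by positivity
    have h2 : (∑' m, ‖x (m + 1) - σ * x m‖ ^ 2) / (1 - |σ|) =
      1 / (1 - |σ|) * ∑' m, ‖x (m + 1) - σ * x m‖ ^ 2 := by ring
    nlinarith
  · set r := |σ|⁻¹ with hr
    have hσ0 : 0 < |σ| := by linarith
    have hr0 : 0 < r := by positivity
    have hr1 : r < 1 := inv_lt_one_of_one_lt₀ h
    have h1 : 0 < 1 - r := by linarith
    refine ⟨1 / (1 - r) / (1 - r), by positivity, fun x hx => ?_⟩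
    have he := hdef x hx
    -- For `|σ| > 1` the recurrence is read backwards, where it contracts by `|σ|⁻¹`; summability of
    -- `x` lets the sum be absorbed.
    have hpt : ∀ m, ‖x m‖ ^ 2 ≤
        r * ‖x (m + 1)‖ ^ 2 + ‖x (m + 1) - σ * x m‖ ^ 2 / (1 - r) := fun m => by
      refine sq_le_of_le_mul_add hr0.le hr1 (norm_nonneg _) ?_
      have h2 := norm_sub_le (x (m + 1)) (x (m + 1) - σ * x m)
      rw [sub_sub_cancel, norm_mul, Complex.norm_real, Real.norm_eq_abs] at h2
      have h3 := mul_le_mul_of_nonneg_left h2 hr0.le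
      rw [← mul_assoc, hr, inv_mul_cancel₀ hσ0.ne', one_mul, ← hr, mul_add] at h3
      nlinarith [norm_nonneg (x (m + 1) - σ * x m)]
    have hsum := hx.tsum_le_tsum hpt
      (((summable_sq_shift 1 hx).mul_left _).add (he.div_const _))
    rw [((summable_sq_shift 1 hx).mul_left _).tsum_add (he.div_const _), tsum_mul_left,
      tsum_div_const] at hsum
    have hsplit := hx.tsum_eq_zero_add
    have hE : 0 ≤ ∑' m, ‖x (m + 1) - σ * x m‖ ^ 2 := tsum_nonneg fun m => by positivity
    rw [div_mul_eq_mul_div, le_div_iff₀ h1]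
    have : 0 ≤ 1 / (1 - r) * ‖x 0‖ ^ 2 := by positivity
    have h2 : (∑' m, ‖x (m + 1) - σ * x m‖ ^ 2) / (1 - r) =
      1 / (1 - r) * ∑' m, ‖x (m + 1) - σ * x m‖ ^ 2 := by ring
    nlinarith [mul_nonneg hr0.le (sq_nonneg ‖x 0‖)]

/-- A family of square-summable sequences whose squared norms are bounded by a multiple of `Q`. -/
def Controlled {W : Type*} (Q : W → ℝ) (g : W → ℕ → ℂ) : Prop :=
  ∃ C : ℝ, 0 ≤ C ∧ ∀ w, Summable (fun m => ‖g w m‖ ^ 2) ∧ ∑' m, ‖g w m‖ ^ 2 ≤ C * Q w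

namespace Controlled

variable {W : Type*} {Q : W → ℝ} {g h : W → ℕ → ℂ}

theorem add (hg : Controlled Q g) (hh : Controlled Q h) :
    Controlled Q fun w m => g w m + h w m := by
  obtain ⟨C, hC, hg⟩ := hg
  obtain ⟨D, hD, hh⟩ := hh
  refine ⟨2 * C + 2 * D, by positivity, fun w => ⟨summable_sq_add (hg w).1 (hh w).1, ?_⟩⟩
  have hpt : ∀ m, ‖g w m + h w m‖ ^ 2 ≤ 2 * ‖g w m‖ ^ 2 + 2 * ‖h w m‖ ^ 2 := fun m => by
    have h1 := pow_le_pow_left₀ (norm_nonneg _) (norm_add_le (g w m) (h w m)) 2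
    nlinarith [sq_nonneg (‖g w m‖ - ‖h w m‖)]
  have hsum := (summable_sq_add (hg w).1 (hh w).1).tsum_le_tsum hpt
    (((hg w).1.mul_left 2).add ((hh w).1.mul_left 2))
  rw [((hg w).1.mul_left 2).tsum_add ((hh w).1.mul_left 2), tsum_mul_left, tsum_mul_left] at hsum
  linarith [(hg w).2, (hh w).2]

theorem const_mul (a : ℂ) (hg : Controlled Q g) : Controlled Q fun w m => a * g w m := by
  obtain ⟨C, hC, hg⟩ := hg
  refine ⟨‖a‖ ^ 2 * C, by positivity, fun w => ⟨summable_sq_const_mul a (hg w).1, ?_⟩⟩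
  simp only [norm_mul, mul_pow]
  rw [tsum_mul_left, mul_assoc]
  exact mul_le_mul_of_nonneg_left (hg w).2 (by positivity)

theorem shift (l : ℕ) (hg : Controlled Q g) : Controlled Q fun w m => g w (m + l) := by
  obtain ⟨C, hC, hg⟩ := hg
  refine ⟨C, hC, fun w => ⟨summable_sq_shift l (hg w).1, le_trans ?_ (hg w).2⟩⟩
  rw [← (hg w).1.sum_add_tsum_nat_add l]
  exact le_add_of_nonneg_left (Finset.sum_nonneg fun m _ => by positivity)

theorem of_first_order (hsum : ∀ w, Summable fun m => ‖g w m‖ ^ 2) {D : ℝ} (hD : 0 ≤ D)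
    (h0 : ∀ w, ‖g w 0‖ ^ 2 ≤ D * Q w) (σ : ℝ) (hσ : |σ| ≠ 1)
    (he : Controlled Q fun w m => g w (m + 1) - σ * g w m) : Controlled Q g := by
  obtain ⟨C, hC, hCx⟩ := tsum_sq_le_of_first_order hσ
  obtain ⟨E, hE, he⟩ := he
  refine ⟨C * (D + E), by positivity, fun w => ⟨hsum w, (hCx _ (hsum w)).trans ?_⟩⟩
  rw [mul_assoc]
  refine mul_le_mul_of_nonneg_left ?_ hC
  linarith [h0 w, (he w).2]

/-- The characteristic polynomial factors: `g (m+1) - ρ g m` obeys a first-order recurrence with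
multiplier `σ`, so `of_first_order` applies twice. -/
theorem of_second_order (hsum : ∀ w, Summable fun m => ‖g w m‖ ^ 2) {D : ℝ} (hD : 0 ≤ D)
    (h0 : ∀ w, ‖g w 0‖ ^ 2 ≤ D * Q w) (h1 : ∀ w, ‖g w 1‖ ^ 2 ≤ D * Q w) (ρ σ : ℝ)
    (hρ : |ρ| ≠ 1) (hσ : |σ| ≠ 1)
    (he : Controlled Q fun w m => g w (m + 2) - (ρ + σ : ℝ) * g w (m + 1) + (ρ * σ : ℝ) * g w m) :
    Controlled Q g := by
  refine of_first_order hsum hD h0 ρ hρ ?_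
  refine of_first_order (D := 2 * D + 2 * (ρ ^ 2 * D)) (fun w => ?_) (by positivity)
    (fun w => ?_) σ hσ ?_
  · have := summable_sq_add (summable_sq_shift 1 (hsum w))
      (summable_sq_const_mul (-(ρ : ℂ)) (hsum w))
    simpa [sub_eq_add_neg] using this
  · have h2 := pow_le_pow_left₀ (norm_nonneg _) (norm_sub_le (g w 1) (ρ * g w 0)) 2
    rw [norm_mul, Complex.norm_real, Real.norm_eq_abs] at h2
    have h3 : (|ρ| * ‖g w 0‖) ^ 2 ≤ ρ ^ 2 * (D * Q w) := by
      rw [mul_pow, sq_abs]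
      exact mul_le_mul_of_nonneg_left (h0 w) (sq_nonneg ρ)
    rw [zero_add]
    nlinarith [sq_nonneg (‖g w 1‖ - |ρ| * ‖g w 0‖), h1 w]
  · convert he using 3
    push_cast
    ring

end Controlled

/-- A quadratic with negative constant term has one root of each sign. -/
theorem exists_roots_of_prod_neg (s q : ℝ) (hq : q < 0) :
    ∃ ρ σ : ℝ, 0 < ρ ∧ σ < 0 ∧ ρ + σ = s ∧ ρ * σ = q := by
  have hd : 0 ≤ s ^ 2 - 4 * q := by nlinarith [sq_nonneg s]
  have hsq := Real.sq_sqrt hd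
  have hlt : |s| < Real.sqrt (s ^ 2 - 4 * q) := by
    rw [← Real.sqrt_sq_eq_abs]
    exact Real.sqrt_lt_sqrt (sq_nonneg s) (by linarith)
  obtain ⟨h1, h2⟩ := abs_lt.1 hlt
  refine ⟨(s + Real.sqrt (s ^ 2 - 4 * q)) / 2, (s - Real.sqrt (s ^ 2 - 4 * q)) / 2,
    by linarith, by linarith, by ring, ?_⟩
  nlinarith

/-- Real roots can meet the unit circle only at `±1`, so it suffices that the characteristic
polynomial does not vanish there. -/
theorem abs_ne_one_of_roots {ρ σ : ℝ} (h1 : 1 - (ρ + σ) + ρ * σ ≠ 0)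
    (h2 : 1 + (ρ + σ) + ρ * σ ≠ 0) : |ρ| ≠ 1 ∧ |σ| ≠ 1 := by
  constructor
  · intro h
    rcases eq_or_eq_neg_of_abs_eq h with rfl | rfl
    · exact h1 (by ring)
    · exact h2 (by ring)
  · intro h
    rcases eq_or_eq_neg_of_abs_eq h with rfl | rfl
    · exact h1 (by ring)
    · exact h2 (by ring)

/-! ### Coercivity at zero quasi-momentum, modulo finitely many cells. -/

theorem norm_sq_eq_tsum (w : Space) : ‖w‖ ^ 2 = ∑' n, ‖w n‖ ^ 2 := by
  have := lp.norm_rpow_eq_tsum (p := 2) (by norm_num) w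
  norm_num at this
  exact this

theorem summable_norm_sq (w : Space) : Summable fun n => ‖w n‖ ^ 2 := by
  have := (lp.memℓp w).summable (by norm_num)
  norm_num at this
  exact this

theorem norm_apply_le (w : Space) (n : ℤ) : ‖w n‖ ≤ ‖w‖ :=
  lp.norm_apply_le_norm (by norm_num) w n

theorem norm_coord_sq_le (v : EuclideanSpace ℂ (Fin 6)) (j : Fin 6) : ‖v j‖ ^ 2 ≤ ‖v‖ ^ 2 :=
  pow_le_pow_left₀ (norm_nonneg _) (PiLp.norm_apply_le v j) 2

theorem summable_right_coord (w : Space) (j : Fin 6) : Summable fun m : ℕ => ‖w (m : ℤ) j‖ ^ 2 :=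
  (summable_coord_sq w j).comp_injective Nat.cast_injective

/-- The quantity that bounds the mass of a sequence in the right half-line. -/
def rightBound (p : Params) (w : Space) : ℝ := ‖ham p 0 w‖ ^ 2 + ‖w 0‖ ^ 2 + ‖w 1‖ ^ 2

theorem controlled_ham (p : Params) (l : ℕ) (j : Fin 6) :
    Controlled (rightBound p) fun w m => hamFun p 0 w ((m : ℤ) + l) j := by
  refine ⟨1, zero_le_one, fun w => ?_⟩
  have hinj : Function.Injective fun m : ℕ => (m : ℤ) + l := fun a b h => by simpa using h
  have hs := (summable_coord_sq (ham p 0 w) j).comp_injective hinj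
  refine ⟨hs, ?_⟩
  calc ∑' m : ℕ, ‖hamFun p 0 w ((m : ℤ) + l) j‖ ^ 2
      ≤ ∑' n, ‖ham p 0 w n j‖ ^ 2 :=
        hs.tsum_le_tsum_of_inj _ hinj (fun n _ => by positivity) (fun m => le_rfl)
          (summable_coord_sq (ham p 0 w) j)
    _ ≤ ∑' n, ‖ham p 0 w n‖ ^ 2 :=
        (summable_coord_sq (ham p 0 w) j).tsum_le_tsum (fun n => norm_coord_sq_le _ j)
          (summable_norm_sq _)
    _ = ‖ham p 0 w‖ ^ 2 := (norm_sq_eq_tsum _).symm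
    _ ≤ 1 * rightBound p w := by
      rw [rightBound]
      nlinarith [sq_nonneg ‖w 0‖, sq_nonneg ‖w 1‖]

theorem norm_add_mul_sq_le {p : Params} {w : Space} {v : EuclideanSpace ℂ (Fin 6)}
    (hv : ‖v‖ ^ 2 ≤ rightBound p w) (i j : Fin 6) {ε : ℂ} (hε : ‖ε‖ = 1) :
    ‖v i + ε * v j‖ ^ 2 ≤ 4 * rightBound p w := by
  have h := pow_le_pow_left₀ (norm_nonneg _) (norm_add_le (v i) (ε * v j)) 2
  rw [norm_mul, hε, one_mul] at h
  nlinarith [norm_coord_sq_le v i, norm_coord_sq_le v j, sq_nonneg (‖v i‖ - ‖v j‖)]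

theorem norm_zero_sq_le (p : Params) (w : Space) : ‖w 0‖ ^ 2 ≤ rightBound p w := by
  rw [rightBound]
  nlinarith [sq_nonneg ‖ham p 0 w‖, sq_nonneg ‖w 1‖]

theorem norm_one_sq_le (p : Params) (w : Space) : ‖w 1‖ ^ 2 ≤ rightBound p w := by
  rw [rightBound]
  nlinarith [sq_nonneg ‖ham p 0 w‖, sq_nonneg ‖w 0‖]

theorem summable_right_comb (w : Space) (i j : Fin 6) (ε : ℂ) :
    Summable fun m : ℕ => ‖w (m : ℤ) i + ε * w (m : ℤ) j‖ ^ 2 :=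
  summable_sq_add (summable_right_coord w i) (summable_sq_const_mul ε (summable_right_coord w j))

theorem controlled_of_comb {p : Params} (i j : Fin 6)
    (h1 : Controlled (rightBound p) fun w m => w (m : ℤ) i + 1 * w (m : ℤ) j)
    (h2 : Controlled (rightBound p) fun w m => w (m : ℤ) i + (-1) * w (m : ℤ) j) :
    Controlled (rightBound p) (fun w m => w (m : ℤ) i) ∧
      Controlled (rightBound p) (fun w m => w (m : ℤ) j) := by
  constructor
  · convert (h1.add h2).const_mul (1 / 2) using 3
    ring
  · convert (h1.add (h2.const_mul (-1))).const_mul (1 / 2) using 3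
    ring

variable {p : Params}

theorem hopB_of_nonneg {n : ℤ} (hn : 0 ≤ n) : hopB p n = p.bPlus := if_pos hn

theorem hopC_of_nonneg {n : ℤ} (hn : 0 ≤ n) : hopC p n = p.bPlus + p.δPlus := if_pos hn

theorem hopD_of_nonneg {n : ℤ} (hn : 0 ≤ n) : hopD p n = p.bPlus + p.δPlus := if_pos hn

/-- The difference of the outer components has bulk multiplier `b / a`; their sum, after elimination
of component `4`, obeys a second-order recurrence. The characteristic polynomial at `1` carries the
factor `b - a`, nonzero since `δ₊ ≠ 0`; at `-1` it is a positive definite form in `a, b`. -/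
theorem controlled_sublattice_right (hb : 0 < p.bPlus) (ha : 0 < p.bPlus + p.δPlus)
    (hδ : p.δPlus ≠ 0) (j : Fin 6) (hj : 3 ≤ j) :
    Controlled (rightBound p) fun w m => w (m : ℤ) j := by
  set b := p.bPlus with hb'
  set a := b + p.δPlus with ha'
  have hab : a ≠ b := by simpa [ha'] using hδ
  have hbC : (b : ℂ) ≠ 0 := by exact_mod_cast hb.ne'
  have haC : (a : ℂ) ≠ 0 := by exact_mod_cast ha.ne'
  have hanti : Controlled (rightBound p) fun w m => w (m : ℤ) 3 + (-1) * w (m : ℤ) 5 := by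
    refine .of_first_order (fun w => summable_right_comb w _ _ _) (D := 4) (by norm_num)
      (fun w => norm_add_mul_sq_le (norm_zero_sq_le p w) 3 5 (by simp)) (b / a) ?_ ?_
    · rw [abs_of_pos (by positivity), ne_eq, div_eq_one_iff_eq ha.ne']
      exact hab.symm
    · convert ((controlled_ham p 0 0).add ((controlled_ham p 0 2).const_mul (-1))).const_mul
        (1 / (a : ℂ)) using 3 with w m
      simp [hamFun, phase_zero, hopB_of_nonneg (p := p) (Int.natCast_nonneg m),
        hopC_of_nonneg (p := p) (Int.natCast_nonneg m), ← hb', ← ha']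
      field_simp
      ring
  obtain ⟨ρ, σ, -, -, hs, hq⟩ := exists_roots_of_prod_neg (a ^ 2 / (2 * b ^ 2)) (-(a / (2 * b)))
    (neg_neg_of_pos (by positivity))
  have hroot : |ρ| ≠ 1 ∧ |σ| ≠ 1 := by
    refine abs_ne_one_of_roots ?_ ?_
    · rw [hs, hq]
      have : 1 - a ^ 2 / (2 * b ^ 2) + -(a / (2 * b)) = (b - a) * (2 * b + a) / (2 * b ^ 2) := by
        field_simp
        ring
      rw [this]
      exact div_ne_zero (mul_ne_zero (sub_ne_zero.2 hab.symm) (by positivity)) (by positivity)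
    · rw [hs, hq]
      have : 1 + a ^ 2 / (2 * b ^ 2) + -(a / (2 * b)) =
          (a ^ 2 - a * b + 2 * b ^ 2) / (2 * b ^ 2) := by
        field_simp
        ring
      rw [this]
      refine div_ne_zero ?_ (by positivity)
      nlinarith [sq_nonneg (a - 2 * b), sq_nonneg (2 * a - b)]
  have hsym : Controlled (rightBound p) fun w m => w (m : ℤ) 3 + 1 * w (m : ℤ) 5 := by
    refine .of_second_order (fun w => summable_right_comb w _ _ _) (D := 4) (by norm_num)
      (fun w => norm_add_mul_sq_le (norm_zero_sq_le p w) 3 5 (by simp))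
      (fun w => norm_add_mul_sq_le (norm_one_sq_le p w) 3 5 (by simp)) ρ σ hroot.1 hroot.2 ?_
    convert (((controlled_ham p 0 0).add (controlled_ham p 0 2)).const_mul
        (a / (2 * b ^ 2) : ℂ)).add ((controlled_ham p 2 1).const_mul (-(1 / b) : ℂ))
        using 3 with w m
    rw [hs, hq]
    simp [hamFun, phase_zero, hopB_of_nonneg (p := p) (Int.natCast_nonneg m),
        hopC_of_nonneg (p := p) (Int.natCast_nonneg m),
        hopD_of_nonneg (p := p) (Int.natCast_nonneg m),
        hopB_of_nonneg (p := p) (n := (m : ℤ) + 2) (by omega), ← hb', ← ha']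
    field_simp
    ring
  obtain ⟨h3, h5⟩ := controlled_of_comb 3 5 hsym hanti
  have h4 : Controlled (rightBound p) fun w m => w (m : ℤ) 4 := by
    convert ((controlled_ham p 2 1).add ((hsym.shift 2).const_mul b)).const_mul
      (-(1 / a) : ℂ) using 3 with w m
    simp [hamFun, phase_zero, hopD_of_nonneg (p := p) (Int.natCast_nonneg m),
        hopB_of_nonneg (p := p) (n := (m : ℤ) + 2) (by omega), ← hb', ← ha']
    field_simp
    ring
  fin_cases j <;> first | exact h3 | exact h4 | exact h5 | simp at hj

theorem controlled_sublattice_left (hb : 0 < p.bPlus) (ha : 0 < p.bPlus + p.δPlus)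
    (hδ : p.δPlus ≠ 0) (j : Fin 6) (hj : j ≤ 2) :
    Controlled (rightBound p) fun w m => w (m : ℤ) j := by
  set b := p.bPlus with hb'
  set a := b + p.δPlus with ha'
  have hab : a ≠ b := by simpa [ha'] using hδ
  have hbC : (b : ℂ) ≠ 0 := by exact_mod_cast hb.ne'
  have haC : (a : ℂ) ≠ 0 := by exact_mod_cast ha.ne'
  have hanti : Controlled (rightBound p) fun w m => w (m : ℤ) 0 + (-1) * w (m : ℤ) 2 := by
    refine .of_first_order (fun w => summable_right_comb w _ _ _) (D := 4) (by norm_num)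
      (fun w => norm_add_mul_sq_le (norm_zero_sq_le p w) 0 2 (by simp)) (a / b) ?_ ?_
    · rw [abs_of_pos (by positivity), ne_eq, div_eq_one_iff_eq hb.ne']
      exact hab
    · convert ((controlled_ham p 1 3).add ((controlled_ham p 1 5).const_mul (-1))).const_mul
        (-(1 / b) : ℂ) using 3 with w m
      simp [hamFun, phase_zero, hopB_of_nonneg (p := p) (n := (m : ℤ) + 1) (by omega),
        hopC_of_nonneg (p := p) (Int.natCast_nonneg m), ← hb', ← ha']
      field_simp
      ring
  obtain ⟨ρ, σ, -, -, hs, hq⟩ := exists_roots_of_prod_neg (-(a / b)) (-(2 * b / a))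
    (neg_neg_of_pos (by positivity))
  have hroot : |ρ| ≠ 1 ∧ |σ| ≠ 1 := by
    refine abs_ne_one_of_roots ?_ ?_
    · rw [hs, hq]
      have : 1 - -(a / b) + -(2 * b / a) = (a - b) * (2 * b + a) / (a * b) := by
        field_simp
        ring
      rw [this]
      exact div_ne_zero (mul_ne_zero (sub_ne_zero.2 hab) (by positivity)) (by positivity)
    · rw [hs, hq]
      have : 1 + -(a / b) + -(2 * b / a) = -((a ^ 2 - a * b + 2 * b ^ 2) / (a * b)) := by
        field_simp
        ring
      rw [this]
      refine neg_ne_zero.2 (div_ne_zero ?_ (by positivity))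
      nlinarith [sq_nonneg (a - 2 * b), sq_nonneg (2 * a - b)]
  have hsym : Controlled (rightBound p) fun w m => w (m : ℤ) 0 + 1 * w (m : ℤ) 2 := by
    refine .of_second_order (fun w => summable_right_comb w _ _ _) (D := 4) (by norm_num)
      (fun w => norm_add_mul_sq_le (norm_zero_sq_le p w) 0 2 (by simp))
      (fun w => norm_add_mul_sq_le (norm_one_sq_le p w) 0 2 (by simp)) ρ σ hroot.1 hroot.2 ?_
    convert (((controlled_ham p 2 3).add (controlled_ham p 2 5)).const_mul
        (-(1 / b) : ℂ)).add ((controlled_ham p 0 4).const_mul (2 / a : ℂ))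
        using 3 with w m
    rw [hs, hq]
    simp [hamFun, phase_zero, hopB_of_nonneg (p := p) (Int.natCast_nonneg m),
        hopD_of_nonneg (p := p) (Int.natCast_nonneg m),
        hopB_of_nonneg (p := p) (n := (m : ℤ) + 2) (by omega),
        hopC_of_nonneg (p := p) (n := (m : ℤ) + 1) (by omega),
        show (m : ℤ) + 2 - 1 = m + 1 by ring, ← hb', ← ha']
    field_simp
    ring
  obtain ⟨h0, h2⟩ := controlled_of_comb 0 2 hsym hanti
  have h1 : Controlled (rightBound p) fun w m => w (m : ℤ) 1 := by
    -- The equations for component `1` at cell `n` involve the bond from `n - 1`, so they are pure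
    -- bulk equations only for `n ≥ 1`. Multiplier `0` reduces the claim to the first term and the
    -- shifted tail.
    refine .of_first_order (fun w => summable_right_coord w 1) (D := 1) (by norm_num)
      (fun w => ?_) 0 (by simp) ?_
    · rw [one_mul]
      exact (norm_coord_sq_le _ 1).trans (norm_zero_sq_le p w)
    convert (((controlled_ham p 1 3).add (controlled_ham p 1 5)).add
      (((hsym.shift 1).const_mul b).add (hsym.const_mul a))).const_mul
      (-(1 / (2 * b)) : ℂ) using 3 with w m
    simp [hamFun, phase_zero, hopC_of_nonneg (p := p) (Int.natCast_nonneg m),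
        hopB_of_nonneg (p := p) (n := (m : ℤ) + 1) (by omega), ← hb', ← ha']
    field_simp
    ring
  fin_cases j <;> first | exact h0 | exact h1 | exact h2 | simp at hj

theorem tsum_right_le (hb : 0 < p.bPlus) (ha : 0 < p.bPlus + p.δPlus) (hδ : p.δPlus ≠ 0) :
    ∃ C : ℝ, 0 ≤ C ∧ ∀ w : Space, ∑' m : ℕ, ‖w (m : ℤ)‖ ^ 2 ≤ C * rightBound p w := by
  have hall : ∀ j : Fin 6, Controlled (rightBound p) fun w m => w (m : ℤ) j := fun j => by
    rcases le_or_gt j 2 with h | h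
    · exact controlled_sublattice_left hb ha hδ j h
    · exact controlled_sublattice_right hb ha hδ j (by omega)
  choose C hC hCw using hall
  refine ⟨∑ j, C j, Finset.sum_nonneg fun j _ => hC j, fun w => ?_⟩
  simp only [EuclideanSpace.norm_sq_eq]
  rw [Summable.tsum_finsetSum fun j _ => summable_right_coord w j, Finset.sum_mul]
  exact Finset.sum_le_sum fun j _ => (hCw j w).2

theorem norm_mirror_apply (w : Space) (n : ℤ) : ‖mirror w n‖ = ‖w (-1 - n)‖ := by
  simp only [EuclideanSpace.norm_eq, mirror_apply]
  congr 1
  exact Equiv.sum_comp Fin.revPerm fun j => ‖w (-1 - n) j‖ ^ 2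

theorem norm_mirror (w : Space) : ‖mirror w‖ = ‖w‖ := by
  rw [← sq_eq_sq₀ (norm_nonneg _) (norm_nonneg _), norm_sq_eq_tsum, norm_sq_eq_tsum]
  simp only [norm_mirror_apply]
  exact (Equiv.subLeft (-1 : ℤ)).tsum_eq fun n => ‖w n‖ ^ 2

/-- Restriction of a sequence to the four cells next to the interface. -/
def window : Space →L[ℂ] (Fin 4 → EuclideanSpace ℂ (Fin 6)) :=
  LinearMap.mkContinuous
    { toFun := fun w i => w ((i : ℤ) - 2)
      map_add' := fun _ _ => rfl
      map_smul' := fun _ _ => rfl } 1 fun w => by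
    rw [one_mul, pi_norm_le_iff_of_nonneg (norm_nonneg w)]
    exact fun i => norm_apply_le w _

theorem norm_le_window (w : Space) (i : Fin 4) : ‖w ((i : ℤ) - 2)‖ ≤ ‖window w‖ :=
  norm_le_pi_norm (window w) i

/-- Zero lies outside the essential spectrum at `k = 0`. -/
theorem hamCLM_zero_coercive (hbp : 0 < p.bPlus) (hbm : 0 < p.bMinus)
    (hdp : 0 < p.bPlus + p.δPlus) (hdm : 0 < p.bMinus + p.δMinus) (hp : p.δPlus ≠ 0)
    (hm : p.δMinus ≠ 0) :
    ∃ C : ℝ, ∀ w, ‖w‖ ≤ C * (‖hamCLM p 0 w‖ + ‖window w‖) := by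
  obtain ⟨C, hC, hCw⟩ := tsum_right_le hbp hdp hp
  obtain ⟨D, hD, hDw⟩ := tsum_right_le (p := p.mirror) hbm hdm hm
  refine ⟨Real.sqrt (2 * (C + D)), fun w => ?_⟩
  have hsplit : ‖w‖ ^ 2 = ∑' m : ℕ, ‖w (m : ℤ)‖ ^ 2 + ∑' m : ℕ, ‖mirror w (m : ℤ)‖ ^ 2 := by
    have h1 : Summable fun m : ℕ => ‖w (m : ℤ)‖ ^ 2 :=
      (summable_norm_sq w).comp_injective Nat.cast_injective
    have h2 : Summable fun m : ℕ => ‖w (-((m : ℤ) + 1))‖ ^ 2 :=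
      (summable_norm_sq w).comp_injective (i := fun m : ℕ => -((m : ℤ) + 1))
        fun a b h => by simpa using h
    have h3 := tsum_of_nat_of_neg_add_one (f := fun n : ℤ => ‖w n‖ ^ 2) h1 h2
    rw [norm_sq_eq_tsum, h3]
    congr 1
    refine tsum_congr fun m => ?_
    rw [norm_mirror_apply, neg_add, sub_eq_add_neg, add_comm]
  have hham : ham p.mirror 0 (mirror w) = mirror (ham p 0 w) := by
    have := ham_mirror p 0 w
    rwa [neg_zero] at this
  set K := ‖window w‖ ^ 2 with hK
  -- The window holds cells `-2, …, 1`: cells `0, 1` serve the right half-line and `-1, -2` serve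
  -- the left one, seen through the mirror.
  have hwin : ∀ i : Fin 4, ‖w ((i : ℤ) - 2)‖ ^ 2 ≤ K := fun i =>
    pow_le_pow_left₀ (norm_nonneg _) (norm_le_window w i) 2
  have hr : rightBound p w ≤ ‖ham p 0 w‖ ^ 2 + 2 * K := by
    have h0 : ‖w 0‖ ^ 2 ≤ K := hwin 2
    have h1 : ‖w 1‖ ^ 2 ≤ K := hwin 3
    rw [rightBound]
    linarith
  have hl : rightBound p.mirror (mirror w) ≤ ‖ham p 0 w‖ ^ 2 + 2 * K := by
    have h0 : ‖w (-1 - 0)‖ ^ 2 ≤ K := hwin 1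
    have h1 : ‖w (-1 - 1)‖ ^ 2 ≤ K := hwin 0
    rw [rightBound, hham, norm_mirror, norm_mirror_apply, norm_mirror_apply]
    linarith
  have h1 := (hCw w).trans (mul_le_mul_of_nonneg_left hr hC)
  have h2 := (hDw (mirror w)).trans (mul_le_mul_of_nonneg_left hl hD)
  have h3 : ‖hamCLM p 0 w‖ = ‖ham p 0 w‖ := rfl
  refine le_of_sq_le_sq ?_ (by positivity)
  rw [mul_pow, Real.sq_sqrt (by positivity), hsplit, h3]
  have h4 : ‖ham p 0 w‖ ^ 2 + 2 * K ≤ 2 * (‖ham p 0 w‖ + ‖window w‖) ^ 2 := by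
    rw [hK]
    nlinarith [norm_nonneg (ham p 0 w), norm_nonneg (window w), sq_nonneg ‖ham p 0 w‖]
  nlinarith [mul_le_mul_of_nonneg_left h4 (add_nonneg hC hD)]

/-! ### Construction of the two zero modes. -/

theorem hopB_pos (hbp : 0 < p.bPlus) (hbm : 0 < p.bMinus) (n : ℤ) : 0 < hopB p n := by
  rw [hopB]
  split_ifs <;> assumption

theorem hopC_pos (hc : 0 < p.c) (hdp : 0 < p.bPlus + p.δPlus) (hdm : 0 < p.bMinus + p.δMinus)
    (n : ℤ) : 0 < hopC p n := by
  rw [hopC]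
  split_ifs <;> assumption

theorem hopD_pos (hc : 0 < p.c) (hdp : 0 < p.bPlus + p.δPlus) (hdm : 0 < p.bMinus + p.δMinus)
    (n : ℤ) : 0 < hopD p n := by
  rw [hopD]
  split_ifs <;> assumption

theorem hopB_of_neg {n : ℤ} (hn : n < 0) : hopB p n = p.bMinus := if_neg (by omega)

theorem hopC_neg_one : hopC p (-1) = p.c := by simp [hopC]

theorem hopC_of_le {n : ℤ} (hn : n ≤ -2) : hopC p n = p.bMinus + p.δMinus := by
  rw [hopC, if_neg (by omega), if_neg (by omega)]

theorem hopD_interface {n : ℤ} (hn : n = -1 ∨ n = -2) : hopD p n = p.c := by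
  rw [hopD, if_neg (by omega), if_pos hn]

theorem hopD_of_le {n : ℤ} (hn : n ≤ -3) : hopD p n = p.bMinus + p.δMinus := by
  rw [hopD, if_neg (by omega), if_neg (by omega)]

/-- The two-sided sequence `…, g 1, g 0, f 0, f 1, …` with `f 0` at position `0`. -/
def glue (f g : ℕ → ℝ) (n : ℤ) : ℝ := if 0 ≤ n then f n.toNat else g (-1 - n).toNat

theorem glue_natCast (f g : ℕ → ℝ) (m : ℕ) : glue f g m = f m := by simp [glue]

theorem glue_neg (f g : ℕ → ℝ) (m : ℕ) : glue f g (-1 - m) = g m := by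
  rw [glue, if_neg (by omega)]
  congr 1
  omega

theorem glue_pos {f g : ℕ → ℝ} (hf : ∀ m, 0 < f m) (hg : ∀ m, 0 < g m) (n : ℤ) :
    0 < glue f g n := by
  rw [glue]
  split_ifs
  · exact hf _
  · exact hg _

theorem memℓp_glue {f g : ℕ → ℝ} (hf : Summable fun m => f m ^ 2)
    (hg : Summable fun m => g m ^ 2) : Memℓp (fun n => (glue f g n : ℂ)) 2 := by
  rw [memℓp_two_iff_summable]
  simp only [Complex.norm_real, Real.norm_eq_abs, sq_abs]
  refine Summable.of_nat_of_neg_add_one ?_ ?_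
  · simpa only [glue_natCast] using hf
  · convert hg using 2 with m
    rw [← glue_neg f g m]
    congr 2
    ring

theorem int_cases (n : ℤ) : (∃ m : ℕ, n = m) ∨ ∃ m : ℕ, n = -1 - m := by
  rcases le_or_gt 0 n with h | h
  · exact .inl ⟨n.toNat, by omega⟩
  · exact .inr ⟨(-1 - n).toNat, by omega⟩

theorem summable_geometric_sq {r : ℝ} (h0 : 0 ≤ r) (h1 : r < 1) :
    Summable fun m : ℕ => (r ^ m) ^ 2 := by
  simpa only [pow_right_comm] using
    summable_geometric_of_lt_one (sq_nonneg r) (by nlinarith : r ^ 2 < 1)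

/-- The zero mode carried by the second sublattice. -/
theorem exists_antisymmetric_mode (hbp : 0 < p.bPlus) (hbm : 0 < p.bMinus) (hc : 0 < p.c)
    (hdp : 0 < p.bPlus + p.δPlus) (hdm : 0 < p.bMinus + p.δMinus) (hp : 0 < p.δPlus)
    (hm : p.δMinus < 0) :
    ∃ z : ℤ → ℝ, (∀ n, 0 < z n) ∧ Memℓp (fun n => (z n : ℂ)) 2 ∧
      ∀ n, hopC p n * z (n + 1) = hopB p n * z n := by
  set r := p.bPlus / (p.bPlus + p.δPlus) with hr
  set q := (p.bMinus + p.δMinus) / p.bMinus with hq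
  have hr0 : 0 < r := by positivity
  have hq0 : 0 < q := by positivity
  have hr1 : r < 1 := by rw [hr, div_lt_one hdp]; linarith
  have hq1 : q < 1 := by rw [hq, div_lt_one hbm]; linarith
  -- The bond at `-1` forces the value `c / b₋` at cell `-1` when the value at `0` is `1`; `r, q <
  -- 1` use the two signs of `δ±`.
  refine ⟨glue (fun m => r ^ m) (fun m => p.c / p.bMinus * q ^ m),
    glue_pos (fun m => by positivity) (fun m => by positivity), memℓp_glue
      (summable_geometric_sq hr0.le hr1) ?_, fun n => ?_⟩
  · simpa only [mul_pow] using (summable_geometric_sq hq0.le hq1).mul_left _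
  · rcases int_cases n with ⟨m, rfl⟩ | ⟨_ | m, rfl⟩
    · rw [← Nat.cast_succ, glue_natCast, glue_natCast, hopB_of_nonneg (by omega),
        hopC_of_nonneg (by omega), pow_succ, hr]
      field_simp
    · have h0 := glue_natCast (fun m => r ^ m) (fun m => p.c / p.bMinus * q ^ m) 0
      have h1 := glue_neg (fun m => r ^ m) (fun m => p.c / p.bMinus * q ^ m) 0
      simp only [Nat.cast_zero, sub_zero, pow_zero, mul_one] at h0 h1
      rw [show (-1 - ((0 : ℕ) : ℤ)) = -1 by norm_num, show (-1 + 1 : ℤ) = 0 by norm_num, h0, h1,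
        hopC_neg_one, hopB_of_neg (by norm_num)]
      field_simp
    · rw [show -1 - ((m + 1 : ℕ) : ℤ) + 1 = -1 - (m : ℤ) by push_cast; ring, glue_neg, glue_neg,
        hopC_of_le (by push_cast; omega), hopB_of_neg (by push_cast; omega), pow_succ, hq]
      field_simp

/-- Since `κ (1 + τ) = θ² < 1`, two steps of the positive recurrence contract by at least `θ²`, and
`M θ ^ m` is a majorant. -/
theorem summable_sq_of_second_order {t : ℕ → ℝ} (ht : ∀ m, 0 < t m) {κ τ : ℝ} (hκ : 0 < κ)
    (hτ : 0 < τ) (h1 : κ * (1 + τ) < 1) (hrec : ∀ m, t (m + 2) = κ * (t m + τ * t (m + 1))) :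
    Summable fun m => t m ^ 2 := by
  set θ := Real.sqrt (κ * (1 + τ)) with hθ
  have hθ0 : 0 < θ := Real.sqrt_pos.2 (by positivity)
  have hθ2 : θ ^ 2 = κ * (1 + τ) := Real.sq_sqrt (by positivity)
  have hθ1 : θ < 1 := by
    rw [hθ, Real.sqrt_lt' one_pos]
    simpa using h1
  set M := max (t 0) (t 1 / θ) with hM
  have hM0 : 0 < M := (ht 0).trans_le (le_max_left _ _)
  have hb : ∀ m, t m ≤ M * θ ^ m ∧ t (m + 1) ≤ M * θ ^ (m + 1) := fun m => by
    induction m with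
    | zero =>
      refine ⟨by simp [hM], ?_⟩
      have := le_max_right (t 0) (t 1 / θ)
      rw [← hM, div_le_iff₀ hθ0] at this
      simpa using this
    | succ m ih =>
      refine ⟨ih.2, ?_⟩
      have h2 : M * θ ^ (m + 1) ≤ M * θ ^ m := by
        rw [pow_succ]
        exact mul_le_mul_of_nonneg_left (mul_le_of_le_one_right (by positivity) hθ1.le) hM0.le
      calc t (m + 2) = κ * (t m + τ * t (m + 1)) := hrec m
        _ ≤ κ * (M * θ ^ m + τ * (M * θ ^ m)) := by
          gcongr
          · exact ih.1
          · exact ih.2.trans h2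
        _ = M * θ ^ m * (κ * (1 + τ)) := by ring
        _ = M * θ ^ (m + 1 + 1) := by rw [← hθ2]; ring
  refine .of_nonneg_of_le (fun m => by positivity)
    (fun m => pow_le_pow_left₀ (ht m).le (hb m).1 2) ?_
  simpa only [mul_pow] using (summable_geometric_sq hθ0.le hθ1).mul_left _

/-- The left half of the zero mode carried by the first sublattice, generated outwards. -/
def leftSeq (κ τ t₀ t₁ : ℝ) : ℕ → ℝ
  | 0 => t₀
  | 1 => t₁
  | m + 2 => κ * (leftSeq κ τ t₀ t₁ m + τ * leftSeq κ τ t₀ t₁ (m + 1))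

theorem leftSeq_pos {κ τ t₀ t₁ : ℝ} (hκ : 0 < κ) (hτ : 0 < τ) (h0 : 0 < t₀) (h1 : 0 < t₁) (m : ℕ) :
    0 < leftSeq κ τ t₀ t₁ m := by
  have : 0 < leftSeq κ τ t₀ t₁ m ∧ 0 < leftSeq κ τ t₀ t₁ (m + 1) := by
    induction m with
    | zero => exact ⟨h0, h1⟩
    | succ m ih =>
      refine ⟨ih.2, ?_⟩
      have h2 := ih.1
      have h3 := ih.2
      rw [leftSeq]
      positivity
  exact this.1

/-- For `b < a` the bulk recurrence has one decaying and one growing solution. -/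
theorem exists_roots_of_lt {a b : ℝ} (hb : 0 < b) (hab : b < a) : ∃ ρ σ : ℝ, 0 < ρ ∧ ρ < 1 ∧
    σ < -1 ∧ ρ + σ = -(a / b) ∧ ρ * σ = -(2 * b / a) := by
  have ha : 0 < a := hb.trans hab
  obtain ⟨ρ, σ, hρ, hσ, hs, hq⟩ := exists_roots_of_prod_neg (-(a / b)) (-(2 * b / a))
    (neg_neg_of_pos (by positivity))
  have h1 : 1 < a / b := by rwa [one_lt_div hb]
  have h2 : b / a < 1 := by rwa [div_lt_one ha]
  have h3 : 2 * b / a = 2 * (b / a) := by ring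
  rw [h3] at hq
  refine ⟨ρ, σ, hρ, ?_, ?_, hs, by rw [hq, h3]⟩
  -- The signs of the characteristic polynomial at `1` and at `-1` locate the roots.
  · have : 0 < (1 - ρ) * (1 - σ) := by nlinarith
    nlinarith
  · have h4 : 0 < b / a := by positivity
    have : (1 + ρ) * (1 + σ) < 0 := by nlinarith
    nlinarith

/-- For `a < b` all solutions of the bulk recurrence grow. -/
theorem exists_roots_of_gt {a b : ℝ} (ha : 0 < a) (hab : a < b) : ∃ ρ σ : ℝ, 1 < ρ ∧
    σ < -1 ∧ ρ + σ = -(a / b) ∧ ρ * σ = -(2 * b / a) := by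
  have hb : 0 < b := ha.trans hab
  obtain ⟨ρ, σ, hρ, hσ, hs, hq⟩ := exists_roots_of_prod_neg (-(a / b)) (-(2 * b / a))
    (neg_neg_of_pos (by positivity))
  have h1 : a / b < 1 := by rwa [div_lt_one hb]
  have h2 : 1 < b / a := by rwa [one_lt_div ha]
  have h3 : 2 * b / a = 2 * (b / a) := by ring
  rw [h3] at hq
  refine ⟨ρ, σ, ?_, ?_, hs, by rw [hq, h3]⟩
  · have : (1 - ρ) * (1 - σ) < 0 := by nlinarith
    nlinarith
  · have h4 : 0 < a / b := by positivity
    have : (1 + ρ) * (1 + σ) < 0 := by nlinarith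
    nlinarith

/-- The zero mode carried by the first sublattice. -/
theorem exists_symmetric_mode (hbp : 0 < p.bPlus) (hbm : 0 < p.bMinus) (hc : 0 < p.c)
    (hdm : 0 < p.bMinus + p.δMinus) (hp : 0 < p.δPlus) (hm : p.δMinus < 0) :
    ∃ x : ℤ → ℝ, (∀ n, 0 < x n) ∧ Memℓp (fun n => (x n : ℂ)) 2 ∧
      ∀ n, 2 * hopB p n * hopB p (n + 2) * x n =
        hopD p n * (hopB p (n + 2) * x (n + 2) + hopC p (n + 1) * x (n + 1)) := by
  obtain ⟨ρ, σ, hρ0, hρ1, -, hs, hq⟩ :=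
    exists_roots_of_lt hbp (by linarith : p.bPlus < p.bPlus + p.δPlus)
  have hroot : 2 * p.bPlus ^ 2 =
      (p.bPlus + p.δPlus) * (p.bPlus * ρ ^ 2 + (p.bPlus + p.δPlus) * ρ) := by
    have h1 : ρ ^ 2 + (p.bPlus + p.δPlus) / p.bPlus * ρ
        - 2 * p.bPlus / (p.bPlus + p.δPlus) = 0 := by
      linear_combination ρ * hs - hq
    field_simp at h1
    linear_combination -h1
  set a := p.bMinus + p.δMinus with ha
  -- Values at cells `-1` and `-2`, forced by the recurrence across the interface from `x 0 = 1` and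
  -- `x 1 = ρ`.
  set t₀ := p.c / (2 * p.bMinus) * (ρ + (p.bPlus + p.δPlus) / p.bPlus) with ht₀
  set t₁ := p.c / (2 * p.bMinus) * (1 + p.c / p.bPlus * t₀) with ht₁
  have hκ : 0 < a / (2 * p.bMinus) := by positivity
  have hτ : 0 < a / p.bMinus := by positivity
  have ht₀0 : 0 < t₀ := by positivity
  have ht₁0 : 0 < t₁ := by positivity
  -- This is where `δ₋ < 0` makes every leftward continuation decay, so only the right half-line
  -- imposes a condition.
  have hκτ : a / (2 * p.bMinus) * (1 + a / p.bMinus) < 1 := by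
    have : a / (2 * p.bMinus) * (1 + a / p.bMinus) =
        a * (p.bMinus + a) / (2 * p.bMinus ^ 2) := by field_simp
    rw [this, div_lt_one (by positivity)]
    nlinarith
  set t := leftSeq (a / (2 * p.bMinus)) (a / p.bMinus) t₀ t₁ with ht
  have htpos : ∀ m, 0 < t m := leftSeq_pos hκ hτ ht₀0 ht₁0
  set x := glue (fun m => ρ ^ m) t with hx
  have hxr : ∀ m : ℕ, x m = ρ ^ m := glue_natCast _ _
  have hxl : ∀ m : ℕ, x (-1 - m) = t m := glue_neg _ _
  refine ⟨x, glue_pos (fun m => by positivity) htpos,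
    memℓp_glue (summable_geometric_sq hρ0.le hρ1)
      (summable_sq_of_second_order htpos hκ hτ hκτ fun m => rfl), fun n => ?_⟩
  have hx0 : x 0 = 1 := by simpa using hxr 0
  have hx1 : x 1 = ρ := by simpa using hxr 1
  have hxm1 : x (-1) = t₀ := hxl 0
  have hxm2 : x (-2) = t₁ := hxl 1
  rcases int_cases n with ⟨m, rfl⟩ | ⟨_ | _ | m, rfl⟩
  · rw [hopB_of_nonneg (by omega), hopB_of_nonneg (by omega), hopD_of_nonneg (by omega),
      hopC_of_nonneg (by omega), hxr, show (m : ℤ) + 2 = ((m + 2 : ℕ) : ℤ) by push_cast; ring, hxr,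
      show (m : ℤ) + 1 = ((m + 1 : ℕ) : ℤ) by push_cast; ring, hxr]
    linear_combination ρ ^ m * hroot
  · rw [show (-1 - ((0 : ℕ) : ℤ)) = -1 by norm_num, show (-1 + 1 : ℤ) = 0 by norm_num,
      show (-1 + 2 : ℤ) = 1 by norm_num, hx0, hx1, hxm1, hopB_of_neg (by norm_num),
      hopB_of_nonneg (by norm_num), hopD_interface (.inl rfl), hopC_of_nonneg (by norm_num), ht₀]
    field_simp
  · rw [show (-1 - ((0 + 1 : ℕ) : ℤ)) = -2 by norm_num, show (-2 + 1 : ℤ) = -1 by norm_num,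
      show (-2 + 2 : ℤ) = 0 by norm_num, hx0, hxm1, hxm2, hopB_of_neg (by norm_num),
      hopB_of_nonneg (by norm_num), hopD_interface (.inr rfl), hopC_neg_one, ht₁]
    field_simp
  · have hrec : t (m + 2) = a / (2 * p.bMinus) * (t m + a / p.bMinus * t (m + 1)) := rfl
    rw [show -1 - ((m + 1 + 1 : ℕ) : ℤ) + 2 = -1 - (m : ℤ) by push_cast; ring,
      show -1 - ((m + 1 + 1 : ℕ) : ℤ) + 1 = -1 - ((m + 1 : ℕ) : ℤ) by push_cast; ring,
      hxl, hxl, hxl, hopB_of_neg (by push_cast; omega), hopB_of_neg (by omega),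
      hopD_of_le (by push_cast; omega), hopC_of_le (by push_cast; omega), hrec, ← ha]
    field_simp

/-! ### Uniqueness of square-summable solutions. -/

theorem eq_zero_of_first_order {x : ℕ → ℂ} (hx : Summable fun m => ‖x m‖ ^ 2) {σ : ℝ}
    (hσ : 1 ≤ |σ|) (hrec : ∀ m, x (m + 1) = σ * x m) (m : ℕ) : x m = 0 := by
  have hmono : Monotone fun m => ‖x m‖ ^ 2 := monotone_nat_of_le_succ fun m => by
    rw [hrec, norm_mul, Complex.norm_real, Real.norm_eq_abs]
    exact pow_le_pow_left₀ (norm_nonneg _) (le_mul_of_one_le_left (norm_nonneg _) hσ) 2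
  have h := hmono.ge_of_tendsto hx.tendsto_atTop_zero m
  have h2 : ‖x m‖ ^ 2 = 0 := le_antisymm h (by positivity)
  simpa using h2

/-- The sequence `x (m+1) - ρ x m` is geometric with ratio `σ`, `|σ| ≥ 1`, so square-summability
forces it to vanish. -/
theorem first_order_of_second_order {x : ℕ → ℂ} (hx : Summable fun m => ‖x m‖ ^ 2) {ρ σ : ℝ}
    (hσ : 1 ≤ |σ|) (hrec : ∀ m, x (m + 2) = (ρ + σ : ℝ) * x (m + 1) - (ρ * σ : ℝ) * x m)
    (m : ℕ) : x (m + 1) = ρ * x m := by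
  refine sub_eq_zero.1 (eq_zero_of_first_order (x := fun m => x (m + 1) - ρ * x m) ?_ hσ ?_ m)
  · have := summable_sq_add (summable_sq_shift 1 hx) (summable_sq_const_mul (-(ρ : ℂ)) hx)
    simpa [sub_eq_add_neg] using this
  · intro m
    simp only [add_assoc, Nat.reduceAdd, hrec]
    push_cast
    ring

theorem summable_right {f : ℤ → ℂ} (hf : Memℓp f 2) : Summable fun m : ℕ => ‖f m‖ ^ 2 :=
  (memℓp_two_iff_summable.1 hf).comp_injective Nat.cast_injective

theorem summable_left {f : ℤ → ℂ} (hf : Memℓp f 2) : Summable fun m : ℕ => ‖f (-1 - m)‖ ^ 2 :=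
  (memℓp_two_iff_summable.1 hf).comp_injective (i := fun m : ℕ => (-1 - m : ℤ))
    fun a b h => by simpa using h

theorem first_order_unique {β γ : ℤ → ℝ} (hβ : ∀ n, β n ≠ 0) (hγ : ∀ n, γ n ≠ 0) {f : ℤ → ℂ}
    (hrec : ∀ n, (γ n : ℂ) * f (n + 1) = β n * f n) (h0 : f 0 = 0) (n : ℤ) : f n = 0 := by
  induction n using Int.induction_on with
  | zero => exact h0
  | succ m ih =>
    have := hrec m
    rw [ih, mul_zero] at this
    exact (mul_eq_zero.1 this).resolve_left (by exact_mod_cast hγ m)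
  | pred m ih =>
    have := hrec (-m - 1)
    rw [sub_add_cancel, ih, mul_zero] at this
    exact (mul_eq_zero.1 this.symm).resolve_left (by exact_mod_cast hβ _)

/-- There is no antisymmetric zero mode on the first sublattice. -/
theorem antisymmetric_eq_zero (hbp : 0 < p.bPlus) (hbm : 0 < p.bMinus) (hc : 0 < p.c)
    (hdp : 0 < p.bPlus + p.δPlus) (hdm : 0 < p.bMinus + p.δMinus) (hp : 0 < p.δPlus)
    {f : ℤ → ℂ} (hf : Memℓp f 2) (hrec : ∀ n, (hopB p (n + 1) : ℂ) * f (n + 1) = hopC p n * f n)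
    (n : ℤ) : f n = 0 := by
  refine first_order_unique (fun n => (hopC_pos hc hdp hdm n).ne')
    (fun n => (hopB_pos hbp hbm (n + 1)).ne') hrec ?_ n
  have hbC : (p.bPlus : ℂ) ≠ 0 := by exact_mod_cast hbp.ne'
  refine eq_zero_of_first_order (summable_right hf) (σ := (p.bPlus + p.δPlus) / p.bPlus)
    ?_ (fun m => ?_) 0
  · rw [abs_of_pos (by positivity), one_le_div hbp]
    linarith
  · have := hrec m
    rw [hopB_of_nonneg (by omega), hopC_of_nonneg (by omega)] at this
    push_cast at this ⊢
    field_simp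
    rw [mul_comm]
    exact this

/-- A zero mode on the first sublattice is determined by its value at the interface. -/
theorem symmetric_unique (hbp : 0 < p.bPlus) (hbm : 0 < p.bMinus)
    (hdp : 0 < p.bPlus + p.δPlus) (hp : 0 < p.δPlus)
    {f : ℤ → ℂ} (hf : Memℓp f 2) (hrec : ∀ n, 2 * (hopB p n : ℂ) * hopB p (n + 2) * f n =
      hopD p n * (hopB p (n + 2) * f (n + 2) + hopC p (n + 1) * f (n + 1)))
    (h0 : f 0 = 0) (n : ℤ) : f n = 0 := by
  obtain ⟨ρ, σ, -, -, hσ, hs, hq⟩ :=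
    exists_roots_of_lt hbp (by linarith : p.bPlus < p.bPlus + p.δPlus)
  have hbC : (p.bPlus : ℂ) ≠ 0 := by exact_mod_cast hbp.ne'
  have haC : (p.bPlus : ℂ) + p.δPlus ≠ 0 := by exact_mod_cast hdp.ne'
  have hfirst : ∀ m : ℕ, f ((m + 1 : ℕ) : ℤ) = ρ * f m := by
    refine first_order_of_second_order (x := fun m : ℕ => f m) (summable_right hf) (σ := σ)
      (by rw [abs_of_neg (by linarith)]; linarith) fun m => ?_
    have := hrec m
    rw [hopB_of_nonneg (by omega), hopB_of_nonneg (by omega), hopC_of_nonneg (by omega),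
      hopD_of_nonneg (by omega)] at this
    rw [hs, hq]
    push_cast at this ⊢
    field_simp
    linear_combination -this
  have hright : ∀ m : ℕ, f m = 0 := fun m => by
    induction m with
    | zero => exact h0
    | succ m ih => rw [hfirst, ih, mul_zero]
  -- The recurrence determines `f n` from its two right neighbours, so vanishing spreads to the
  -- left.
  have hleft : ∀ m : ℕ, f (-m) = 0 ∧ f (-m + 1) = 0 := fun m => by
    induction m with
    | zero => exact ⟨by simpa using h0, by simpa using hright 1⟩
    | succ m ih =>
      have h1 : -((m + 1 : ℕ) : ℤ) + 1 = -m := by push_cast; ring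
      have h2 : -((m + 1 : ℕ) : ℤ) + 2 = -m + 1 := by push_cast; ring
      refine ⟨?_, by rw [h1]; exact ih.1⟩
      have := hrec (-((m + 1 : ℕ) : ℤ))
      rw [h1, h2, ih.1, ih.2, mul_zero, mul_zero, add_zero, mul_zero] at this
      refine (mul_eq_zero.1 this).resolve_left ?_
      have hb1 := (hopB_pos hbp hbm (-((m + 1 : ℕ) : ℤ))).ne'
      have hb2 := (hopB_pos hbp hbm (-m + 1)).ne'
      exact mul_ne_zero (mul_ne_zero two_ne_zero (by exact_mod_cast hb1)) (by exact_mod_cast hb2)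
  rcases int_cases n with ⟨m, rfl⟩ | ⟨m, rfl⟩
  · exact hright m
  · have := (hleft (m + 1)).1
    rwa [show -((m + 1 : ℕ) : ℤ) = -1 - m by push_cast; ring] at this

/-- There is no symmetric zero mode on the second sublattice. -/
theorem symmetric_eq_zero (hbp : 0 < p.bPlus) (hbm : 0 < p.bMinus)
    (hdm : 0 < p.bMinus + p.δMinus) (hm : p.δMinus < 0)
    {f : ℤ → ℂ} (hf : Memℓp f 2) (hrec : ∀ n, 2 * (hopB p n : ℂ) * hopB p (n + 2) * f (n + 2) =
      hopD p n * (hopB p n * f n + hopC p n * f (n + 1))) (n : ℤ) : f n = 0 := by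
  obtain ⟨ρ, σ, hρ, hσ, hs, hq⟩ :=
    exists_roots_of_gt hdm (by linarith : p.bMinus + p.δMinus < p.bMinus)
  have hbC : (p.bMinus : ℂ) ≠ 0 := by exact_mod_cast hbm.ne'
  have haC : (p.bMinus : ℂ) + p.δMinus ≠ 0 := by exact_mod_cast hdm.ne'
  -- Read leftwards, both bulk roots exceed `1` in modulus. Removing `σ` here and `ρ` in `hleft`
  -- kills the left half, and the recurrence carries the zero to the right.
  have hfirst := first_order_of_second_order (x := fun m : ℕ => f (-1 - m)) (summable_left hf)
    (ρ := ρ) (σ := σ) (by rw [abs_of_neg (by linarith)]; linarith) fun m => by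
      have := hrec (-1 - ((m + 2 : ℕ) : ℤ))
      rw [show -1 - ((m + 2 : ℕ) : ℤ) + 2 = -1 - (m : ℤ) by push_cast; ring,
        show -1 - ((m + 2 : ℕ) : ℤ) + 1 = -1 - ((m + 1 : ℕ) : ℤ) by push_cast; ring,
        hopB_of_neg (by push_cast; omega), hopB_of_neg (by omega),
        hopC_of_le (by push_cast; omega), hopD_of_le (by push_cast; omega)] at this
      rw [hs, hq]
      generalize f (-1 - ((m + 2 : ℕ) : ℤ)) = A at this ⊢
      generalize f (-1 - ((m + 1 : ℕ) : ℤ)) = B at this ⊢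
      push_cast at this ⊢
      field_simp
      linear_combination -this
  have hleft : ∀ m : ℕ, f (-1 - m) = 0 := eq_zero_of_first_order (x := fun m : ℕ => f (-1 - m))
    (summable_left hf) (by rw [abs_of_pos (by linarith)]; linarith) hfirst
  have hright : ∀ m : ℕ, f ((m : ℤ) - 2) = 0 ∧ f ((m : ℤ) - 1) = 0 := fun m => by
    induction m with
    | zero => exact ⟨by simpa using hleft 1, by simpa using hleft 0⟩
    | succ m ih =>
      have h1 : (m : ℤ) - 2 + 1 = m - 1 := by ring
      have h2 : (m : ℤ) - 2 + 2 = ((m + 1 : ℕ) : ℤ) - 1 := by push_cast; ring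
      have h3 : ((m + 1 : ℕ) : ℤ) - 2 = m - 1 := by push_cast; ring
      refine ⟨by rw [h3]; exact ih.2, ?_⟩
      have := hrec ((m : ℤ) - 2)
      rw [h1, h2, ih.1, ih.2, mul_zero, mul_zero, add_zero, mul_zero] at this
      refine (mul_eq_zero.1 this).resolve_left ?_
      have hb1 := (hopB_pos hbp hbm ((m : ℤ) - 2)).ne'
      have hb2 := (hopB_pos hbp hbm (((m + 1 : ℕ) : ℤ) - 1)).ne'
      exact mul_ne_zero (mul_ne_zero two_ne_zero (by exact_mod_cast hb1)) (by exact_mod_cast hb2)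
  rcases int_cases n with ⟨m, rfl⟩ | ⟨m, rfl⟩
  · have := (hright (m + 2)).1
    rwa [show ((m + 2 : ℕ) : ℤ) - 2 = m by push_cast; ring] at this
  · exact hleft m

/-! ### The kernel at zero quasi-momentum and its coupling. -/

theorem hamDeriv_isSelfAdjoint (p : Params) : IsSelfAdjoint (hamDeriv p) :=
  (hamCLM_isSelfAdjoint p _).sub (IsSelfAdjoint.smul (by simp [IsSelfAdjoint])
    ((hamCLM_isSelfAdjoint p _).add (hamCLM_isSelfAdjoint p _)))

/-- The middle component of the symmetric zero mode with outer components `x`. -/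
def middle (p : Params) (x : ℤ → ℝ) (n : ℤ) : ℝ :=
  -x n - hopC p (n - 1) / hopB p n * x (n - 1)

theorem memℓp_middle (hbp : 0 < p.bPlus) (hbm : 0 < p.bMinus) {x : ℤ → ℝ}
    (hx : Memℓp (fun n => (x n : ℂ)) 2) : Memℓp (fun n => (middle p x n : ℂ)) 2 := by
  have h1 := memℓp_bdd_mul (memℓp_shift hx (-1))
    (fun n => -((hopC p (n - 1) / hopB p n : ℝ) : ℂ))
    (hopBound p * (1 / p.bPlus + 1 / p.bMinus)) fun n => by
      have hC := hopC_norm p (n - 1)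
      rw [norm_neg, Complex.norm_real, Real.norm_eq_abs] at hC ⊢
      rw [abs_div, div_eq_mul_one_div]
      refine mul_le_mul hC ?_ (by positivity) ((abs_nonneg _).trans hC)
      have h1 : 0 < 1 / p.bPlus := by positivity
      have h2 : 0 < 1 / p.bMinus := by positivity
      rw [abs_of_pos (hopB_pos hbp hbm n), hopB]
      split_ifs <;> linarith
  convert hx.neg.add h1 using 1
  funext n
  simp [middle, sub_eq_add_neg]

/-- The zero mode on the first sublattice with outer components `x`. -/
def modeA (p : Params) (x : ℤ → ℝ) (hx : Memℓp (fun n => (x n : ℂ)) 2)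
    (hy : Memℓp (fun n => (middle p x n : ℂ)) 2) : Space :=
  ofCoord ![fun n => (x n : ℂ), fun n => (middle p x n : ℂ), fun n => (x n : ℂ), 0, 0, 0]
    fun j => by fin_cases j <;> first | exact hx | exact hy | exact zero_memℓp

/-- The zero mode on the second sublattice with outer components `z` and `-z`. -/
def modeB (z : ℤ → ℝ) (hz : Memℓp (fun n => (z n : ℂ)) 2) : Space :=
  ofCoord ![0, 0, 0, fun n => (z n : ℂ), 0, -fun n => (z n : ℂ)]
    fun j => by fin_cases j <;> first | exact hz | exact hz.neg | exact zero_memℓp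

/-- Of the four decoupled scalar problems two have only the zero solution and two are
one-dimensional; `α` and `β` are read off at cell `0`. -/
theorem exists_eq_of_ham_zero (hbp : 0 < p.bPlus) (hbm : 0 < p.bMinus) (hc : 0 < p.c)
    (hdp : 0 < p.bPlus + p.δPlus) (hdm : 0 < p.bMinus + p.δMinus) (hp : 0 < p.δPlus)
    (hm : p.δMinus < 0) {x z : ℤ → ℝ} (hx0 : x 0 ≠ 0) (hx : Memℓp (fun n => (x n : ℂ)) 2)
    (hy : Memℓp (fun n => (middle p x n : ℂ)) 2)
    (hxrec : ∀ n, 2 * hopB p n * hopB p (n + 2) * x n =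
        hopD p n * (hopB p (n + 2) * x (n + 2) + hopC p (n + 1) * x (n + 1)))
    (hz0 : z 0 ≠ 0) (hz : Memℓp (fun n => (z n : ℂ)) 2)
    (hzrec : ∀ n, hopC p n * z (n + 1) = hopB p n * z n) {w : Space} (hw : hamCLM p 0 w = 0) :
    ∃ α β : ℂ, w = α • modeA p x hx hy + β • modeB z hz := by
  have hB : ∀ n, (hopB p n : ℂ) ≠ 0 := fun n => by exact_mod_cast (hopB_pos hbp hbm n).ne'
  have hD : ∀ n, (hopD p n : ℂ) ≠ 0 := fun n => by exact_mod_cast (hopD_pos hc hdp hdm n).ne'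
  have hw' : ∀ n j, hamFun p 0 w n j = 0 := fun n j => congrArg (fun v : Space => v n j) hw
  have r0 := fun n => hw' n 0
  have r1 := fun n => hw' n 1
  have r2 := fun n => hw' n 2
  have r3 := fun n => hw' n 3
  have r4 := fun n => hw' n 4
  have r5 := fun n => hw' n 5
  simp [hamFun, phase_zero] at r0 r1 r2 r3 r4 r5
  have hx0C : (x 0 : ℂ) ≠ 0 := by exact_mod_cast hx0
  have hz0C : (z 0 : ℂ) ≠ 0 := by exact_mod_cast hz0
  have hxrecC : ∀ n, 2 * (hopB p n : ℂ) * hopB p (n + 2) * x n =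
        hopD p n * (hopB p (n + 2) * x (n + 2) + hopC p (n + 1) * x (n + 1)) := fun n => by
    exact_mod_cast hxrec n
  have hzrecC : ∀ n, (hopC p n : ℂ) * z (n + 1) = hopB p n * z n := fun n => by
    exact_mod_cast hzrec n
  have hAanti : ∀ n, w n 0 - w n 2 = 0 :=
    antisymmetric_eq_zero hbp hbm hc hdp hdm hp
      (f := fun n => w n 0 - w n 2) ((memℓp_coord w 0).sub (memℓp_coord w 2)) fun n => by
      have h3 := r3 (n + 1)
      have h5 := r5 (n + 1)
      rw [add_sub_cancel_right] at h3 h5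
      linear_combination h5 - h3
  have hBsym : ∀ n, w n 3 + w n 5 = 0 :=
    symmetric_eq_zero hbp hbm hdm hm
      (f := fun n => w n 3 + w n 5) ((memℓp_coord w 3).add (memℓp_coord w 5)) fun n => by
      have h1 := r1 (n + 2)
      rw [add_sub_cancel_right] at h1
      linear_combination hopD p n * (r0 n + r2 n) - 2 * hopB p n * h1
  have hB4 : ∀ n, w n 4 = 0 := fun n => by
    have h1 := r1 (n + 2)
    rw [add_sub_cancel_right] at h1
    refine (mul_eq_zero.1 ?_).resolve_left (hD n)
    linear_combination -h1 - hopB p (n + 2) * hBsym (n + 2)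
  set α := w 0 0 / x 0 with hα
  set β := w 0 3 / z 0 with hβ
  have hBanti : ∀ n, w n 3 - β * z n = 0 := by
    refine first_order_unique (fun n => (hopB_pos hbp hbm n).ne')
      (fun n => (hopC_pos hc hdp hdm n).ne') (f := fun n => w n 3 - β * z n) (fun n => ?_) ?_
    · linear_combination -r2 n - β * hzrecC n - hopB p n * hBsym n - hopB p n * hB4 n
    · simp only [hβ]
      field_simp
      ring
  have hA1 : ∀ n, (hopB p n : ℂ) * w n 1 =
      -(hopB p n * w n 0 + hopC p (n - 1) * w (n - 1) 0) := fun n => by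
    linear_combination -r3 n + hopC p (n - 1) * hAanti (n - 1)
  have hAsym : ∀ n, w n 0 - α * x n = 0 := by
    refine symmetric_unique hbp hbm hdp hp (f := fun n => w n 0 - α * x n) ?_ (fun n => ?_) ?_
    · have h2 := (memℓp_coord w 0).add (memℓp_bdd_mul hx (fun _ => -α) ‖α‖ fun _ => by simp)
      convert h2 using 1
      funext n
      simp [sub_eq_add_neg]
    · have h1 := hA1 (n + 2)
      rw [show n + 2 - 1 = n + 1 by ring] at h1
      linear_combination -α * hxrecC n - hopB p (n + 2) * r4 n - hopD p n * h1
        + hopB p (n + 2) * hopB p n * hAanti n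
    · simp only [hα]
      field_simp
      ring
  refine ⟨α, β, ?_⟩
  ext n j
  change w n j = α * modeA p x hx hy n j + β * modeB z hz n j
  fin_cases j <;> simp [modeA, modeB, ofCoord_apply]
  · linear_combination hAsym n
  · refine mul_left_cancel₀ (hB n) ?_
    rw [hA1, middle]
    push_cast
    have := hB n
    field_simp
    linear_combination -(hopB p n : ℂ) * hAsym n - hopC p (n - 1) * hAsym (n - 1)
  · linear_combination hAsym n - hAanti n
  · linear_combination hBanti n
  · exact hB4 n
  · linear_combination hBsym n - hBanti n

theorem inner_eq_zero_of_forall {u w : Space} (h : ∀ n, inner ℂ (u n) (w n) = 0) :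
    inner ℂ u w = 0 := by
  rw [lp.inner_eq_tsum]
  simp [h]

/-- This matrix element sets the slope. The middle component of the second mode is zero, so only the
`hopC` bonds contribute, and positivity of hoppings and profiles rules out cancellation. -/
theorem exists_inner_modes (hc : 0 < p.c) (hdp : 0 < p.bPlus + p.δPlus)
    (hdm : 0 < p.bMinus + p.δMinus) {x z : ℤ → ℝ} (hxpos : ∀ n, 0 < x n)
    (hzpos : ∀ n, 0 < z n) (hx : Memℓp (fun n => (x n : ℂ)) 2)
    (hy : Memℓp (fun n => (middle p x n : ℂ)) 2) (hz : Memℓp (fun n => (z n : ℂ)) 2) :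
    ∃ m : ℝ, 0 < m ∧
      inner ℂ (modeA p x hx hy) (hamDeriv p (modeB z hz)) = -Complex.I * m := by
  have hsum := lp.hasSum_inner (𝕜 := ℂ) (modeA p x hx hy) (hamDeriv p (modeB z hz))
  have hterm : ∀ n, inner ℂ (modeA p x hx hy n) (hamDeriv p (modeB z hz) n) =
      -Complex.I * ((hopC p n * x n * z (n + 1) : ℝ) : ℂ) := fun n => by
    rw [hamDeriv_apply]
    simp [PiLp.inner_apply, Fin.sum_univ_six, modeA, modeB, ofCoord_apply]
    ring
  simp only [hterm] at hsum
  have hpos : ∀ n, 0 < hopC p n * x n * z (n + 1) := fun n =>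
    mul_pos (mul_pos (hopC_pos hc hdp hdm n) (hxpos n)) (hzpos _)
  have hs : Summable fun n => hopC p n * x n * z (n + 1) := by
    have h1 := hsum.summable.mul_left Complex.I
    simp only [← mul_assoc, mul_neg, Complex.I_mul_I, neg_neg, one_mul] at h1
    exact Complex.summable_ofReal.1 (by simpa only [mul_assoc] using h1)
  refine ⟨∑' n, hopC p n * x n * z (n + 1), hs.tsum_pos (fun n => (hpos n).le) 0 (hpos 0), ?_⟩
  refine hsum.unique ?_
  exact ((Complex.hasSum_ofReal.2 hs.hasSum).mul_left _)

/-! ### Linear branches of eigenvalues. -/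

/-- The linear branch of eigenvalues emanating from zero. -/
theorem exists_branch_of_pos (hbp : 0 < p.bPlus) (hbm : 0 < p.bMinus) (hc : 0 < p.c)
    (hdp : 0 < p.bPlus + p.δPlus) (hdm : 0 < p.bMinus + p.δMinus) (hp : 0 < p.δPlus)
    (hm : p.δMinus < 0) :
    ∃ μ : ℝ, 0 < μ ∧ ∃ D : ℝ, ∀ᶠ k in 𝓝 (0 : ℝ), ∃ e : ℝ,
      Module.End.HasEigenvalue (ham p k) (e : ℂ) ∧ |e - μ * k| ≤ D * k ^ 2 := by
  obtain ⟨x, hxpos, hx, hxrec⟩ := exists_symmetric_mode hbp hbm hc hdm hp hm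
  obtain ⟨z, hzpos, hz, hzrec⟩ := exists_antisymmetric_mode hbp hbm hc hdp hdm hp hm
  have hy := memℓp_middle hbp hbm hx
  obtain ⟨m, hm0, hinner⟩ := exists_inner_modes hc hdp hdm hxpos hzpos hx hy hz
  obtain ⟨B, hB⟩ := norm_hamCLM_sub_le p
  obtain ⟨C, hC⟩ := hamCLM_zero_coercive hbp hbm hdp hdm hp.ne' hm.ne
  have hker := fun w (hw : hamCLM p 0 w = 0) =>
    exists_eq_of_ham_zero hbp hbm hc hdp hdm hp hm (hxpos 0).ne' hx hy hxrec (hzpos 0).ne' hz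
      hzrec hw
  have hUker : hamCLM p 0 (modeA p x hx hy) = 0 := by
    refine eq_zero_of_coord fun n j => ?_
    rw [hamCLM_apply]
    have hb : ∀ n, (hopB p n : ℂ) ≠ 0 := fun n => by exact_mod_cast (hopB_pos hbp hbm n).ne'
    have hb0 := hb n
    have hb2 := hb (n + 2)
    have hrec : 2 * (hopB p n : ℂ) * hopB p (n + 2) * x n =
        hopD p n * (hopB p (n + 2) * x (n + 2) + hopC p (n + 1) * x (n + 1)) := by
      exact_mod_cast hxrec n
    fin_cases j <;> simp [hamFun, modeA, ofCoord_apply, phase_zero, middle]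
    · field_simp
      ring
    · rw [show n + 2 - 1 = n + 1 by ring]
      field_simp
      linear_combination -hrec
    · field_simp
      ring
  have hVker : hamCLM p 0 (modeB z hz) = 0 := by
    refine eq_zero_of_coord fun n j => ?_
    rw [hamCLM_apply]
    have hrec : (hopC p n : ℂ) * z (n + 1) = hopB p n * z n := by exact_mod_cast hzrec n
    fin_cases j <;> simp [hamFun, modeB, ofCoord_apply, phase_zero]
    · linear_combination hrec
    · linear_combination -hrec
  set U := modeA p x hx hy with hU
  set V := modeB z hz with hV
  have hU0 : U ≠ 0 := fun h => (hxpos 0).ne' (by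
    have := congrArg (fun v : Space => v 0 0) h
    simpa [hU, modeA, ofCoord_apply] using this)
  have hV0 : V ≠ 0 := fun h => (hzpos 0).ne' (by
    have := congrArg (fun v : Space => v 0 3) h
    simpa [hV, modeB, ofCoord_apply] using this)
  have hUV : inner ℂ U V = 0 := inner_eq_zero_of_forall fun n => by
    simp [PiLp.inner_apply, Fin.sum_univ_six, hU, hV, modeA, modeB, ofCoord_apply]
  have hVU : inner ℂ V U = 0 := inner_eq_zero_symm.1 hUV
  have hUU : inner ℂ U (hamDeriv p U) = 0 := inner_eq_zero_of_forall fun n => by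
    rw [hamDeriv_apply]
    simp [PiLp.inner_apply, Fin.sum_univ_six, hU, modeA, ofCoord_apply]
  have hVV : inner ℂ V (hamDeriv p V) = 0 := inner_eq_zero_of_forall fun n => by
    rw [hamDeriv_apply]
    simp [PiLp.inner_apply, Fin.sum_univ_six, hV, modeB, ofCoord_apply]
  have hVU' : inner ℂ V (hamDeriv p U) = Complex.I * m := by
    have h1 : inner ℂ (hamDeriv p V) U = inner ℂ V (hamDeriv p U) :=
      ContinuousLinearMap.isSelfAdjoint_iff_isSymmetric.1 (hamDeriv_isSelfAdjoint p) V U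
    rw [← h1, ← inner_conj_symm, hinner]
    simp
  have hUn : 0 < ‖U‖ := norm_pos_iff.2 hU0
  have hVn : 0 < ‖V‖ := norm_pos_iff.2 hV0
  have hUnC : (‖U‖ : ℂ) ≠ 0 := by exact_mod_cast hUn.ne'
  have hVnC : (‖V‖ : ℂ) ≠ 0 := by exact_mod_cast hVn.ne'
  have hUsq : inner ℂ U U = (‖U‖ : ℂ) ^ 2 := inner_self_eq_norm_sq_to_K U
  have hVsq : inner ℂ V V = (‖V‖ : ℂ) ^ 2 := inner_self_eq_norm_sq_to_K V
  -- In the basis `U/‖U‖, V/‖V‖` the derivative is the Hermitian matrix with off-diagonal entries `∓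
  -- i μ`; `w₀` is proportional to its eigenvector `(1, i)` for the eigenvalue `μ`.
  set w₀ : Space := (‖V‖ : ℂ) • U + (Complex.I * ‖U‖) • V with hw₀
  have hUw : inner ℂ U w₀ = (‖V‖ : ℂ) * ‖U‖ ^ 2 := by
    rw [hw₀, inner_add_right, inner_smul_right, inner_smul_right, hUV, hUsq, mul_zero, add_zero]
  have hVw : inner ℂ V w₀ = Complex.I * ‖U‖ * ‖V‖ ^ 2 := by
    rw [hw₀, inner_add_right, inner_smul_right, inner_smul_right, hVU, hVsq, mul_zero, zero_add]
  have hw₀0 : w₀ ≠ 0 := fun h => by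
    rw [h, inner_zero_right] at hUw
    exact mul_ne_zero hVnC (pow_ne_zero 2 hUnC) hUw.symm
  set μ : ℝ := m / (‖U‖ * ‖V‖) with hμ
  have hμC : (μ : ℂ) = m / (‖U‖ * ‖V‖) := by rw [hμ]; push_cast; rfl
  refine ⟨μ, by positivity, ?_⟩
  have hmain := exists_eigenvalue_near_of_first_order (hamCLM p) (hamDeriv p)
    (hamCLM_isSelfAdjoint p) B hB window C hC μ w₀ hw₀0
    (by rw [hw₀, map_add, map_smul, map_smul, hUker, hVker, smul_zero, smul_zero, add_zero]) ?_
  · exact hmain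
  · intro y hy0
    obtain ⟨α, β, rfl⟩ := hker y hy0
    have h1 : inner ℂ U (hamDeriv p w₀ - (μ : ℂ) • w₀) = 0 := by
      rw [inner_sub_right, inner_smul_right, hUw, hw₀, map_add, map_smul, map_smul,
        inner_add_right, inner_smul_right, inner_smul_right, hUU, hinner, hμC]
      field_simp
      linear_combination (-(m * ‖U‖ : ℂ)) * Complex.I_sq
    have h2 : inner ℂ V (hamDeriv p w₀ - (μ : ℂ) • w₀) = 0 := by
      rw [inner_sub_right, inner_smul_right, hVw, hw₀, map_add, map_smul, map_smul,
        inner_add_right, inner_smul_right, inner_smul_right, hVV, hVU', hμC]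
      field_simp
      ring
    rw [inner_add_left, inner_smul_left, inner_smul_left, h1, h2, mul_zero, mul_zero, add_zero]

/-- The mirror exchanges `δ₊` and `δ₋` but turns `k` into `-k`; the chiral symmetry `e ↦ -e`
restores the slope `μ`. -/
theorem exists_branch (hbp : 0 < p.bPlus) (hbm : 0 < p.bMinus) (hc : 0 < p.c)
    (hdp : 0 < p.bPlus + p.δPlus) (hdm : 0 < p.bMinus + p.δMinus)
    (hδ : p.δPlus * p.δMinus < 0) :
    ∃ μ : ℝ, 0 < μ ∧ ∃ D : ℝ, ∀ᶠ k in 𝓝 (0 : ℝ), ∃ e : ℝ,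
      Module.End.HasEigenvalue (ham p k) (e : ℂ) ∧ |e - μ * k| ≤ D * k ^ 2 := by
  rcases mul_neg_iff.1 hδ with ⟨hp, hm⟩ | ⟨hp, hm⟩
  · exact exists_branch_of_pos hbp hbm hc hdp hdm hp hm
  · obtain ⟨μ, hμ, D, hD⟩ := exists_branch_of_pos (p := p.mirror) hbm hbp hc hdm hdp hm hp
    refine ⟨μ, hμ, D, ?_⟩
    have hneg : Tendsto (fun k : ℝ => -k) (𝓝 0) (𝓝 0) := by
      simpa using (continuous_neg (G := ℝ)).tendsto 0
    filter_upwards [hneg.eventually hD] with k hk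
    obtain ⟨e, he, hb⟩ := hk
    refine ⟨-e, ?_, ?_⟩
    · rw [Complex.ofReal_neg]
      exact ham_hasEigenvalue_neg (ham_hasEigenvalue_mirror he)
    · rw [← abs_neg]
      convert hb using 1
      · congr 1
        ring
      · ring

end TypeII

end

theorem mainTheorem4 (p : TypeII.Params)
    (hbp : 0 < p.bPlus) (hbm : 0 < p.bMinus) (hc : 0 < p.c)
    (hdp : 0 < p.bPlus + p.δPlus) (hdm : 0 < p.bMinus + p.δMinus)
    (hδ : p.δPlus * p.δMinus < 0) :
    ∃ E₁ : ℝ, E₁ ≠ 0 ∧ ∃ Eplus Eminus : ℝ → ℝ,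
      (∀ᶠ k in 𝓝[≠] (0 : ℝ),
        Eminus k ≠ Eplus k ∧
        Module.End.HasEigenvalue (TypeII.ham p k) (Eplus k : ℂ) ∧
        Module.End.HasEigenvalue (TypeII.ham p k) (Eminus k : ℂ)) ∧
      (fun k => Eplus k - E₁ * |k|) =O[𝓝[≠] (0 : ℝ)] (fun k => k ^ 2) ∧
      (fun k => Eminus k - (-(E₁ * |k|))) =O[𝓝[≠] (0 : ℝ)] (fun k => k ^ 2) := by
  obtain ⟨μ, hμ, D, hD⟩ := TypeII.exists_branch hbp hbm hc hdp hdm hδ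
  -- For `k < 0` the chiral partner `-e` is taken, which replaces `μ k` by `μ |k|`.
  have hD' : ∀ᶠ k in 𝓝 (0 : ℝ), ∃ e : ℝ,
      Module.End.HasEigenvalue (TypeII.ham p k) (e : ℂ) ∧ |e - μ * (|k|)| ≤ D * k ^ 2 := by
    filter_upwards [hD] with k hk
    obtain ⟨e, he, hb⟩ := hk
    rcases le_total 0 k with h | h
    · exact ⟨e, he, by rwa [abs_of_nonneg h]⟩
    · refine ⟨-e, ?_, ?_⟩
      · rw [Complex.ofReal_neg]
        exact TypeII.ham_hasEigenvalue_neg he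
      · rw [abs_of_nonpos h, ← abs_neg]
        convert hb using 2
        ring
  have hchoice : ∀ k : ℝ, ∃ e : ℝ, (∃ e' : ℝ,
      Module.End.HasEigenvalue (TypeII.ham p k) (e' : ℂ) ∧ |e' - μ * (|k|)| ≤ D * k ^ 2) →
      Module.End.HasEigenvalue (TypeII.ham p k) (e : ℂ) ∧ |e - μ * (|k|)| ≤ D * k ^ 2 := fun k => by
    by_cases h : ∃ e' : ℝ,
      Module.End.HasEigenvalue (TypeII.ham p k) (e' : ℂ) ∧ |e' - μ * (|k|)| ≤ D * k ^ 2
    · obtain ⟨e, he⟩ := h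
      exact ⟨e, fun _ => he⟩
    -- An arbitrary value away from the neighbourhood of zero where eigenvalues are known; only the
    -- germ at zero matters.
    · exact ⟨0, fun h' => absurd h' h⟩
  choose E hE using hchoice
  have hEv : ∀ᶠ k in 𝓝[≠] (0 : ℝ),
      Module.End.HasEigenvalue (TypeII.ham p k) (E k : ℂ) ∧ |E k - μ * (|k|)| ≤ D * k ^ 2 :=
    (hD'.mono fun k hk => hE k hk).filter_mono nhdsWithin_le_nhds
  -- In this range the error `D k²` is below `μ |k|`, so `E k > 0` and the two branches are
  -- distinct.
  have hsmall : ∀ᶠ k in 𝓝[≠] (0 : ℝ), D * |k| < μ := by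
    have h1 : Tendsto (fun k : ℝ => D * |k|) (𝓝 0) (𝓝 (D * |0|)) :=
      (by fun_prop : Continuous fun k : ℝ => D * |k|).tendsto 0
    rw [abs_zero, mul_zero] at h1
    exact (h1.eventually_lt_const hμ).filter_mono nhdsWithin_le_nhds
  refine ⟨μ, hμ.ne', E, fun k => -E k, ?_, ?_, ?_⟩
  · filter_upwards [hEv, hsmall, self_mem_nhdsWithin] with k hk hk' hk0
    have hkpos : 0 < |k| := abs_pos.2 hk0
    have hEpos : 0 < E k := by
      have h1 := (abs_le.1 hk.2).1
      rw [← sq_abs k] at h1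
      nlinarith
    refine ⟨by linarith, hk.1, ?_⟩
    rw [Complex.ofReal_neg]
    exact TypeII.ham_hasEigenvalue_neg hk.1
  · refine IsBigO.of_bound D (hEv.mono fun k hk => ?_)
    rw [Real.norm_eq_abs, Real.norm_of_nonneg (sq_nonneg k)]
    exact hk.2
  · refine IsBigO.of_bound D (hEv.mono fun k hk => ?_)
    rw [Real.norm_eq_abs, Real.norm_of_nonneg (sq_nonneg k), ← abs_neg]
    convert hk.2 using 2
    ring
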